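/- Let $M$ be a transitive model of ZFC (a set or a proper class), and work in the ambient universe $V\supseteq M$. Let $R\in M$ be a commutative ring with $1$. Let $\operatorname{Spec}(R)^M$ be the set of prime ideals of $R$ that belong to $M$; for $a\in R$ put $O_a^M=\{P\in\operatorname{Spec}(R)^M\mid a\notin P\}$, and let $L_R$ be the frame, ordered by inclusion, of the sets that are open in $M$ for the topology on $\operatorname{Spec}(R)^M$ generated in $M$ by the sets $O_a^M$. A filter $\mathcal F\subseteq L_R$ (in $V$) is *completely prime over $M$* if for every $\mathcal U\in M$ with $\mathcal U\subseteq L_R$ whose join belongs to $\mathcal F$ we have $\mathcal F\cap\mathcal U\neq\varnothing$. Let $\widehat{L_R}$ be the space of all filters on $L_R$ that are completely prime over $M$, with the topology generated by the sets $\{\mathcal F\mid U\in\mathcal F\}$, $U\in L_R$. Then $\widehat{L_R}$ is naturally homeomorphic to the space $\operatorname{Spec}(R)$ of all prime ideals of $R$ in $V$ with the Zariski topology. Explicitly, each $O_a^M$ belongs to $L_R$, and the maps $$\mathcal F\mapsto P_{\mathcal F}=\{a\in R\mid O_a^M\notin\mathcal F\},\qquad P\mapsto \mathcal F_P=\{U\in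 L_R\mid O_a^M\subseteq U\text{ for some }a\in R\setminus P\}$$ are mutually inverse homeomorphisms $e_R\colon\widehat{L_R}\to\operatorname{Spec}(R)$ and $e_R^{-1}$. They are natural in $R$: if $\varphi\colon R\to S$ is a homomorphism of commutative rings with $1$, where $R,S,\varphi\in M$, then for $U\in L_R$ the set $\varphi^*U=\{Q\in\operatorname{Spec}(S)^M\mid\varphi^{-1}(Q)\in U\}$ belongs to $L_S$; for $\mathcal F\in\widehat{L_S}$ the set $\{U\in L_R\mid\varphi^*U\in\mathcal F\}$ is a point of $\widehat{L_R}$; and $e_R$ maps this point to $\varphi^{-1}(e_S(\mathcal F))$. -/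

import Mathlib

open FirstOrder

universe u

noncomputable section

namespace LocaleInterpretation

/-! ### The first-order theory ZFC -/

/-- The relation symbols of the language of set theory: one binary symbol. -/
inductive SetRel : ℕ → Type
  | mem : SetRel 2

/-- The first-order language `{∈}` of set theory. -/
def setLang : Language where
  Functions := fun _ => Empty
  Relations := SetRel

/-- The symbol `∈`. -/
abbrev memSym : setLang.Relations 2 := SetRel.mem

/-- A class `M` of sets is a structure for the language of set theory, with the true `∈`. -/
instance classStructure (M : Set ZFSet.{u}) : setLang.Structure M where
  funMap := fun f => f.elim
  RelMap := fun r => match r with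
    | SetRel.mem => fun v => (v 0 : ZFSet.{u}) ∈ (v 1 : ZFSet.{u})

/-- The atomic formula `xᵢ ∈ xⱼ` in the variables `x₀, …, xₘ₋₁`. The quantifiers `∀'` and `∃'`,
applied to a formula in the variables `x₀, …, xₘ`, bind the variable `xₘ`. -/
def vMem {m : ℕ} (i j : ℕ) (hi : i < m := by omega) (hj : j < m := by omega) :
    setLang.BoundedFormula Empty m :=
  Language.Relations.boundedFormula₂ memSym
    (Language.Term.var (Sum.inr ⟨i, hi⟩)) (Language.Term.var (Sum.inr ⟨j, hj⟩))

/-- The atomic formula `xᵢ = xⱼ` in the variables `x₀, …, xₘ₋₁`. -/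
def vEq {m : ℕ} (i j : ℕ) (hi : i < m := by omega) (hj : j < m := by omega) :
    setLang.BoundedFormula Empty m :=
  Language.Term.bdEqual
    (Language.Term.var (Sum.inr ⟨i, hi⟩)) (Language.Term.var (Sum.inr ⟨j, hj⟩))

/-- `φ(x₀, …, xₙ₋₁, xᵢ)` as a formula in the variables `x₀, …, xₘ₋₁`. -/
def inst₁ {n m : ℕ} (φ : setLang.Formula (Fin (n + 1))) (i : ℕ)
    (hn : n ≤ m := by omega) (hi : i < m := by omega) : setLang.BoundedFormula Empty m :=
  Language.BoundedFormula.relabel (n := m) (k := 0)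
    (fun k : Fin (n + 1) => Sum.inr (if h : (k : ℕ) < n then ⟨k, h.trans_le hn⟩ else ⟨i, hi⟩)) φ

/-- `φ(x₀, …, xₙ₋₁, xᵢ, xⱼ)` as a formula in the variables `x₀, …, xₘ₋₁`. -/
def inst₂ {n m : ℕ} (φ : setLang.Formula (Fin (n + 2))) (i j : ℕ)
    (hn : n ≤ m := by omega) (hi : i < m := by omega) (hj : j < m := by omega) :
    setLang.BoundedFormula Empty m :=
  Language.BoundedFormula.relabel (n := m) (k := 0)
    (fun k : Fin (n + 2) => Sum.inr (if h : (k : ℕ) < n then ⟨k, h.trans_le hn⟩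
      else if (k : ℕ) = n then ⟨i, hi⟩ else ⟨j, hj⟩)) φ

/-- Sets with the same elements are equal. -/
def axExtensionality : setLang.Sentence :=
  ∀' ∀' ((∀' (vMem 2 0 ⇔ vMem 2 1)) ⟹ vEq 0 1)

/-- Every nonempty set has an `∈`-minimal element. -/
def axFoundation : setLang.Sentence :=
  ∀' ((∃' vMem 1 0) ⟹ ∃' (vMem 1 0 ⊓ ∼ (∃' (vMem 2 1 ⊓ vMem 2 0))))

/-- Unordered pairs exist. -/
def axPairing : setLang.Sentence :=
  ∀' ∀' ∃' ∀' (vMem 3 2 ⇔ (vEq 3 0 ⊔ vEq 3 1))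

/-- The union of a set exists. -/
def axUnion : setLang.Sentence :=
  ∀' ∃' ∀' (vMem 2 1 ⇔ ∃' (vMem 3 0 ⊓ vMem 2 3))

/-- The power set of a set exists. -/
def axPowerset : setLang.Sentence :=
  ∀' ∃' ∀' (vMem 2 1 ⇔ ∀' (vMem 3 2 ⟹ vMem 3 0))

/-- There is a set that contains the empty set and, with each `x`, also `x ∪ {x}`. -/
def axInfinity : setLang.Sentence :=
  ∃' ((∃' (vMem 1 0 ⊓ ∀' ∼ (vMem 2 1))) ⊓
    ∀' (vMem 1 0 ⟹ ∃' (vMem 2 0 ⊓ ∀' (vMem 3 2 ⇔ (vMem 3 1 ⊔ vEq 3 1)))))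

/-- Every family of nonempty pairwise disjoint sets has a set that meets each member of the
family in exactly one element. -/
def axChoice : setLang.Sentence :=
  ∀' (((∀' (vMem 1 0 ⟹ ∃' vMem 2 1)) ⊓
      (∀' ∀' ((vMem 1 0 ⊓ vMem 2 0 ⊓ ∃' (vMem 3 1 ⊓ vMem 3 2)) ⟹ vEq 1 2))) ⟹
    ∃' ∀' (vMem 2 0 ⟹
      ∃' ((vMem 3 2 ⊓ vMem 3 1) ⊓ ∀' ((vMem 4 2 ⊓ vMem 4 1) ⟹ vEq 4 3))))

/-- Separation for `φ(p₀, …, pₙ₋₁, x)`: for all `p` and `a`, the set `{x ∈ a | φ(p, x)}` exists. -/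
def axSeparation {n : ℕ} (φ : setLang.Formula (Fin (n + 1))) : setLang.Sentence :=
  Language.BoundedFormula.alls (n := n)
    (∀' ∃' ∀' (vMem (n + 2) (n + 1) ⇔ (vMem (n + 2) n ⊓ inst₁ φ (n + 2))))

/-- Replacement for `φ(p₀, …, pₙ₋₁, x, y)`: for all `p` and `a`, if for every `x ∈ a` there is at
most one `y` with `φ(p, x, y)`, then the set of all `y` with `φ(p, x, y)` for some `x ∈ a`
exists. -/
def axReplacement {n : ℕ} (φ : setLang.Formula (Fin (n + 2))) : setLang.Sentence :=
  Language.BoundedFormula.alls (n := n)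
    (∀' ((∀' (vMem (n + 1) n ⟹
        ∀' ∀' ((inst₂ φ (n + 1) (n + 2) ⊓ inst₂ φ (n + 1) (n + 3)) ⟹ vEq (n + 2) (n + 3)))) ⟹
      ∃' ∀' (vMem (n + 2) (n + 1) ⇔ ∃' (vMem (n + 3) n ⊓ inst₂ φ (n + 3) (n + 2)))))

/-- Zermelo–Fraenkel set theory with choice. -/
def ZFC : setLang.Theory :=
  {axExtensionality, axFoundation, axPairing, axUnion, axPowerset, axInfinity, axChoice} ∪
    {σ | ∃ (n : ℕ) (φ : setLang.Formula (Fin (n + 1))), σ = axSeparation φ} ∪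
    {σ | ∃ (n : ℕ) (φ : setLang.Formula (Fin (n + 2))), σ = axReplacement φ}

/-! ### Points of a locale over a model -/

section Hat

variable (M : Set ZFSet.{u}) (L : ZFSet.{u}) [PartialOrder L]

/-- A filter `F` on `L` is completely prime over `M` if it meets every set `𝒰 ∈ M` of elements
of `L` whose join belongs to `F`. -/
def IsCompletelyPrimeOver (F : Order.PFilter L) : Prop :=
  ∀ 𝒰 ∈ M, 𝒰 ⊆ L → ∀ U ∈ F, IsLUB {l : L | (l : ZFSet.{u}) ∈ 𝒰} U →
    ∃ l ∈ F, (l : ZFSet.{u}) ∈ 𝒰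

/-- The space `L̂` of filters on `L` that are completely prime over `M`. -/
def Hat : Type (u + 1) :=
  {F : Order.PFilter L // IsCompletelyPrimeOver M L F}

/-- The topology of `L̂` is generated by the sets `{F | l ∈ F}`, `l ∈ L`. -/
instance hatTopology : TopologicalSpace (Hat M L) :=
  TopologicalSpace.generateFrom {s | ∃ l : L, s = {F : Hat M L | l ∈ F.1}}

end Hat

/-! ### Commutative rings in a model, and their spectra as computed in the model -/

/-- A commutative ring with `1` that is an element of `M`: its underlying set and the graphs of
its addition and multiplication are elements of `M`. -/
structure RingIn (M : Set ZFSet.{u}) where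
  carrier : ZFSet.{u}
  [ring : CommRing carrier]
  carrier_mem : carrier ∈ M
  add_mem : ZFSet.range (fun p : carrier × carrier =>
    ZFSet.pair (ZFSet.pair p.1 p.2) (p.1 + p.2 : carrier)) ∈ M
  mul_mem : ZFSet.range (fun p : carrier × carrier =>
    ZFSet.pair (ZFSet.pair p.1 p.2) (p.1 * p.2 : carrier)) ∈ M

attribute [instance] RingIn.ring

/-- The ring homomorphism `φ` is an element of `M`. -/
def HomIn {M : Set ZFSet.{u}} {R S : RingIn M} (φ : R.carrier →+* S.carrier) : Prop :=
  ZFSet.range (fun a : R.carrier => ZFSet.pair a (φ a)) ∈ M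

section Spec

variable {M : Set ZFSet.{u}} (R : RingIn M)

/-- The set `P` is (the underlying set of) a prime ideal of `R`. -/
def IsPrimeIdeal (P : ZFSet.{u}) : Prop :=
  ∃ I : Ideal R.carrier, I.IsPrime ∧ P = ZFSet.range (fun a : I => ((a : R.carrier) : ZFSet.{u}))

/-- The set of points of `Spec R` as computed in `M`: the prime ideals of `R` that are elements
of `M`. -/
def specIn : ZFSet.{u} :=
  ZFSet.sep (fun P => P ∈ M ∧ IsPrimeIdeal R P) (ZFSet.powerset R.carrier)

/-- The set `O_a = {P | a ∉ P}` as computed in `M`. -/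
def basicOpenIn (a : R.carrier) : ZFSet.{u} :=
  ZFSet.sep (fun P => (a : ZFSet.{u}) ∉ P) (specIn R)

variable (M) in
/-- `M` satisfies: `T` is a topology on the set `X`. -/
structure IsTopologyIn (X T : ZFSet.{u}) : Prop where
  mem : T ∈ M
  subset : ∀ U ∈ T, U ⊆ X
  univ_mem : X ∈ T
  inter_mem : ∀ U ∈ T, ∀ V ∈ T, U ∩ V ∈ T
  sUnion_mem : ∀ 𝒰 ∈ M, 𝒰 ⊆ T → (ZFSet.sUnion 𝒰 : ZFSet.{u}) ∈ T

/-- The set of open subsets of `Spec R` as computed in `M`: the sets that belong to every `T ∈ M`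
that is, in `M`, a topology containing all `O_a`. Like every set of sets, it is ordered by
inclusion. -/
def opensIn : ZFSet.{u} :=
  ZFSet.sep (fun U => U ∈ M ∧ ∀ T, IsTopologyIn M (specIn R) T →
    (∀ a : R.carrier, basicOpenIn R a ∈ T) → U ∈ T) (ZFSet.powerset (specIn R))

variable {R} in
/-- For a ring homomorphism `φ : R → S` and a subset `U` of `Spec R` as computed in `M`, the
preimage `{Q | φ⁻¹(Q) ∈ U}` under the map `Spec S → Spec R` as computed in `M`. -/
def specPreimageIn {S : RingIn M} (φ : R.carrier →+* S.carrier) (U : ZFSet.{u}) : ZFSet.{u} :=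
  ZFSet.sep (fun Q => ZFSet.sep (fun x => ∃ h : x ∈ R.carrier, (φ ⟨x, h⟩ : ZFSet.{u}) ∈ Q)
    R.carrier ∈ U) (specIn S)

end Spec

end LocaleInterpretation

end

open LocaleInterpretation

/-!
The points of `Spec R` as computed in `M` are only the prime ideals that belong to `M`, yet the
completely prime filters on the frame of open sets of this space recover all prime ideals of `R`.
Every open set is, in `M`, a union of basic open sets `O_a`, so a filter that is completely prime
over `M` is determined by the set of all `a` with `O_a` in the filter (`Hat.mem_iff`), and the
relations between the `O_a` make the complement of this set a prime ideal (`Hat.toPrimeSpectrum`).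

Conversely, the filter of a prime ideal `P` is completely prime over `M` because prime ideals in `M`
decide the relevant inclusions: if `P` contains a set `B ∈ M` but not `a`, then so does some prime
ideal in `M` (`exists_mem_specIn_of_isPrime`). This has two ingredients.

* The radical ideal generated by `B` can be formed in `M`, and it lies in `P` although `P` need not
  belong to `M` (`exists_radical_set_mem_model`). Here the well-foundedness of the true membership
  relation enters, through the ordinals of `M`.
* A radical ideal in `M` without `a` extends to a prime ideal in `M` without `a`
  (`exists_prime_set_mem_model`). This is Zorn's lemma inside `M` (`exists_maximal_mem_model`), for
  which the Bourbaki–Witt argument is carried out with sets that are elements of `M`.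

That a set described by a first-order formula over `M` belongs to `M` is the axiom scheme of
separation. The classes `DefPred` and `DefFun` express definability over `M` with parameters; their
instances are the closure properties of definability, so that instance search replaces writing out
formulas. The axiom scheme of replacement is not needed, since all sets in question are subsets of
iterated power sets.

Naturality holds because `φ*U` is covered in `M` by the sets `O_{φ(a)}` with `O_a ⊆ U`
(`HomIn.specPreimageIn_mem_iff`).
-/

namespace LocaleInterpretation

/-! ### Definability with parameters over a class -/

section Definability

variable (M : Set ZFSet.{u})

/-- A context for formulas with parameters from `M`: a type of assignments together with the
functions on it that count as atomic terms, among them the constants. Contexts are built from the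
trivial one, `PUnit`, by `Γ ↦ Γ × M`, which adds a variable. -/
class Ctx (Γ : Type (u + 1)) where
  /-- The atomic terms of the context. -/
  vars : Set (Γ → M)
  const_mem : ∀ c : M, (fun _ => c) ∈ vars

instance : Ctx M PUnit.{u + 2} where
  vars := Set.range fun c _ => c
  const_mem c := ⟨c, rfl⟩

instance Ctx.prod (Γ : Type (u + 1)) [Ctx M Γ] : Ctx M (Γ × M) where
  vars := insert Prod.snd ((fun v => v ∘ Prod.fst) '' Ctx.vars)
  const_mem c := Or.inr ⟨_, Ctx.const_mem c, rfl⟩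

variable {Γ Γ' Δ : Type (u + 1)} [Ctx M Γ] [Ctx M Γ'] [Ctx M Δ]

/-- The predicate `p` on assignments is the truth value in `M` of a first-order formula with
parameters from `M`. This is a class in order that the closure properties of definability, stated
as instances, find the formulas. -/
class DefPred (p : Γ → Prop) : Prop where
  exists_formula : ∃ φ : setLang.Formula (Ctx.vars : Set (Γ → M)),
    ∀ γ, φ.Realize (M := M) (fun v => v.1 γ) ↔ p γ

/-- The function `f` takes values in `M`, and its graph is definable with parameters over `M`. -/
class DefFun (f : Γ → ZFSet.{u}) : Prop where
  mem : ∀ γ, f γ ∈ M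
  graph : DefPred M (fun δ : Γ × M => (δ.2 : ZFSet.{u}) = f δ.1)

/-- The set `c` is an element of `M`, so that it may serve as a parameter. -/
class InM (c : ZFSet.{u}) : Prop where
  mem : c ∈ M

/-- A map of contexts that forgets variables. -/
class IsWeakening (g : Γ' → Γ) : Prop where
  comp_mem : ∀ v ∈ (Ctx.vars : Set (Γ → M)), v ∘ g ∈ (Ctx.vars : Set (Γ' → M))

instance : IsWeakening M (fun γ : Γ => γ) := ⟨fun _ hv => hv⟩

instance IsWeakening.fst (g : Δ → Γ × M) [hg : IsWeakening M g] :
    IsWeakening M (fun γ => (g γ).1) :=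
  ⟨fun v hv => hg.comp_mem (v ∘ Prod.fst) (Or.inr ⟨v, hv, rfl⟩)⟩

theorem IsWeakening.prodMap (g : Γ' → Γ) [hg : IsWeakening M g] :
    IsWeakening M (fun δ : Γ' × M => (g δ.1, δ.2)) := by
  refine ⟨?_⟩
  rintro _ (rfl | ⟨v, hv, rfl⟩)
  · exact Or.inl rfl
  · exact Or.inr ⟨v ∘ g, hg.comp_mem v hv, rfl⟩

variable {M}

theorem DefPred.weaken {p : Γ → Prop} (hp : DefPred M p) (g : Γ' → Γ) [hg : IsWeakening M g] :
    DefPred M (fun γ => p (g γ)) := by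
  obtain ⟨φ, hφ⟩ := hp
  refine ⟨φ.relabel (fun v => ⟨v.1 ∘ g, hg.comp_mem v.1 v.2⟩), fun γ => ?_⟩
  rw [Language.Formula.realize_relabel, ← hφ]
  rfl

theorem DefFun.weaken {f : Γ → ZFSet.{u}} (hf : DefFun M f) (g : Γ' → Γ)
    [hg : IsWeakening M g] : DefFun M (fun γ => f (g γ)) := by
  have := IsWeakening.prodMap M g
  exact ⟨fun γ => hf.mem _, hf.graph.weaken (fun δ : Γ' × M => (g δ.1, δ.2))⟩

theorem DefPred.congr {p q : Γ → Prop} (hp : DefPred M p) (h : ∀ γ, p γ ↔ q γ) :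
    DefPred M q := by
  rwa [← funext fun γ => propext (h γ)]

instance DefPred.not (p : Γ → Prop) [hp : DefPred M p] : DefPred M (fun γ => ¬ p γ) := by
  obtain ⟨φ, hφ⟩ := hp
  exact ⟨φ.not, fun γ => by rw [Language.Formula.realize_not, hφ]⟩

instance DefPred.and (p q : Γ → Prop) [hp : DefPred M p] [hq : DefPred M q] :
    DefPred M (fun γ => p γ ∧ q γ) := by
  obtain ⟨φ, hφ⟩ := hp
  obtain ⟨ψ, hψ⟩ := hq
  exact ⟨φ ⊓ ψ, fun γ => by rw [Language.Formula.realize_inf, hφ, hψ]⟩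

instance DefPred.or (p q : Γ → Prop) [hp : DefPred M p] [hq : DefPred M q] :
    DefPred M (fun γ => p γ ∨ q γ) :=
  DefPred.congr (inferInstance : DefPred M (fun γ => ¬ (¬ p γ ∧ ¬ q γ))) fun γ => by tauto

instance DefPred.imp (p q : Γ → Prop) [hp : DefPred M p] [hq : DefPred M q] :
    DefPred M (fun γ => p γ → q γ) :=
  DefPred.congr (inferInstance : DefPred M (fun γ => ¬ (p γ ∧ ¬ q γ))) fun γ => by tauto

instance DefPred.iff (p q : Γ → Prop) [hp : DefPred M p] [hq : DefPred M q] :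
    DefPred M (fun γ => p γ ↔ q γ) :=
  DefPred.congr (inferInstance : DefPred M (fun γ => (p γ → q γ) ∧ (q γ → p γ)))
    fun γ => by tauto

theorem DefPred.exists_snd {p : Γ × M → Prop} (hp : DefPred M p) :
    DefPred M (fun γ => ∃ x : M, p (γ, x)) := by
  classical
  obtain ⟨φ, hφ⟩ := hp
  have key : ∀ v : (Ctx.vars : Set (Γ × M → M)),
      ∃ w : (Ctx.vars : Set (Γ → M)) ⊕ Fin 1,
        ∀ γ x, Sum.elim (fun v : (Ctx.vars : Set (Γ → M)) => v.1 γ) (fun _ => x) w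
          = v.1 (γ, x) := by
    rintro ⟨_, rfl | ⟨v, hv, rfl⟩⟩
    · exact ⟨Sum.inr 0, fun γ x => rfl⟩
    · exact ⟨Sum.inl ⟨v, hv⟩, fun γ x => rfl⟩
  choose w hw using key
  refine ⟨(φ.relabel w).iExs (Fin 1), fun γ => ?_⟩
  rw [Language.Formula.realize_iExs]
  constructor
  · rintro ⟨i, hi⟩
    refine ⟨i 0, (hφ _).1 ?_⟩
    rw [Language.Formula.realize_relabel] at hi
    convert hi using 1
    funext v
    rw [← hw v γ (i 0), Function.comp_apply]
    congr 1
    funext k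
    rw [Subsingleton.elim k 0]
  · rintro ⟨x, hx⟩
    refine ⟨fun _ => x, ?_⟩
    rw [Language.Formula.realize_relabel]
    convert (hφ (γ, x)).2 hx using 1
    funext v
    exact hw v γ x

instance DefPred.exists_mem_class (p : Γ → ZFSet.{u} → Prop)
    [hp : DefPred M (fun δ : Γ × M => p δ.1 δ.2)] : DefPred M (fun γ => ∃ x ∈ M, p γ x) :=
  hp.exists_snd.congr fun γ => by simp

instance DefPred.forall_mem_class (p : Γ → ZFSet.{u} → Prop)
    [hp : DefPred M (fun δ : Γ × M => p δ.1 δ.2)] : DefPred M (fun γ => ∀ x ∈ M, p γ x) :=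
  DefPred.congr (inferInstance : DefPred M (fun γ => ¬ ∃ x ∈ M, ¬ p γ x)) fun γ => by
    push Not; rfl

/-- Substitution of a definable function in a definable predicate. -/
theorem DefPred.subst {p : Γ × M → Prop} (hp : DefPred M p) {f : Γ → ZFSet.{u}}
    (hf : DefFun M f) : DefPred M (fun γ => p (γ, ⟨f γ, hf.mem γ⟩)) := by
  have h1 := hf.graph
  refine (DefPred.exists_snd (p := fun δ : Γ × M => (δ.2 : ZFSet.{u}) = f δ.1 ∧ p δ)
    inferInstance).congr fun γ => ?_
  constructor
  · rintro ⟨x, hx, hp⟩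
    obtain rfl : x = ⟨f γ, hf.mem γ⟩ := Subtype.ext hx
    exact hp
  · exact fun h => ⟨_, rfl, h⟩

theorem DefPred.eq_vars {v w : Γ → M} (hv : v ∈ (Ctx.vars : Set (Γ → M)))
    (hw : w ∈ (Ctx.vars : Set (Γ → M))) :
    DefPred M (fun γ => (v γ : ZFSet.{u}) = w γ) := by
  refine ⟨Language.Term.equal (Language.Term.var ⟨v, hv⟩) (Language.Term.var ⟨w, hw⟩),
    fun γ => ?_⟩
  rw [Language.Formula.realize_equal]
  exact Subtype.ext_iff

theorem DefPred.mem_vars {v w : Γ → M} (hv : v ∈ (Ctx.vars : Set (Γ → M)))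
    (hw : w ∈ (Ctx.vars : Set (Γ → M))) :
    DefPred M (fun γ => (v γ : ZFSet.{u}) ∈ (w γ : ZFSet.{u})) := by
  refine ⟨Language.Relations.formula₂ memSym (Language.Term.var ⟨v, hv⟩)
    (Language.Term.var ⟨w, hw⟩), fun γ => ?_⟩
  rw [Language.Formula.realize_rel₂]
  rfl

theorem DefFun.of_vars {v : Γ → M} (hv : v ∈ (Ctx.vars : Set (Γ → M))) :
    DefFun M (fun γ => (v γ : ZFSet.{u})) :=
  ⟨fun γ => (v γ).2, DefPred.eq_vars (v := Prod.snd) (w := v ∘ Prod.fst) (Or.inl rfl)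
    (Or.inr ⟨v, hv, rfl⟩)⟩

instance DefFun.snd (g : Δ → Γ × M) [hg : IsWeakening M g] :
    DefFun M (fun γ => ((g γ).2 : ZFSet.{u})) :=
  DefFun.of_vars (hg.comp_mem Prod.snd (Or.inl rfl))

instance DefFun.const (c : ZFSet.{u}) [hc : InM M c] : DefFun M (fun _ : Γ => c) :=
  DefFun.of_vars (Ctx.const_mem (⟨c, hc.mem⟩ : M))

instance DefPred.mem (f g : Γ → ZFSet.{u}) [hf : DefFun M f] [hg : DefFun M g] :
    DefPred M (fun γ => f γ ∈ g γ) := by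
  have h : DefPred M (fun δ : (Γ × M) × M => (δ.1.2 : ZFSet.{u}) ∈ (δ.2 : ZFSet.{u})) :=
    DefPred.mem_vars (v := Prod.snd ∘ Prod.fst) (w := Prod.snd)
      (Or.inr ⟨_, Or.inl rfl, rfl⟩) (Or.inl rfl)
  exact (h.subst (hg.weaken Prod.fst (hg := IsWeakening.fst M (fun δ => δ)))).subst hf

instance DefPred.eq (f g : Γ → ZFSet.{u}) [hf : DefFun M f] [hg : DefFun M g] :
    DefPred M (fun γ => f γ = g γ) := by
  have h : DefPred M (fun δ : (Γ × M) × M => (δ.1.2 : ZFSet.{u}) = (δ.2 : ZFSet.{u})) :=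
    DefPred.eq_vars (v := Prod.snd ∘ Prod.fst) (w := Prod.snd)
      (Or.inr ⟨_, Or.inl rfl, rfl⟩) (Or.inl rfl)
  exact (h.subst (hg.weaken Prod.fst (hg := IsWeakening.fst M (fun δ => δ)))).subst hf

/-- A definable function without variables is an element of the model. -/
theorem DefFun.mem_of_const {c : ZFSet.{u}} (h : DefFun M (fun _ : PUnit.{u + 2} => c)) : c ∈ M :=
  h.mem PUnit.unit

theorem DefFun.of_graph {f : Γ → ZFSet.{u}} (hM : ∀ γ, f γ ∈ M) (r : Γ → ZFSet.{u} → Prop)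
    [hr : DefPred M (fun δ : Γ × M => r δ.1 δ.2)] (h : ∀ γ, ∀ y ∈ M, r γ y ↔ y = f γ) :
    DefFun M f :=
  ⟨hM, hr.congr fun δ => h δ.1 δ.2 δ.2.2⟩

@[simp]
theorem realize_vMem {m : ℕ} (i j : ℕ) (hi : i < m) (hj : j < m) (v : Empty → M) (xs : Fin m → M) :
    (vMem i j hi hj).Realize v xs ↔ (xs ⟨i, hi⟩ : ZFSet.{u}) ∈ (xs ⟨j, hj⟩ : ZFSet.{u}) := by
  rw [vMem, Language.BoundedFormula.realize_rel₂]
  rfl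

@[simp]
theorem realize_vEq {m : ℕ} (i j : ℕ) (hi : i < m) (hj : j < m) (v : Empty → M) (xs : Fin m → M) :
    (vEq i j hi hj).Realize v xs ↔ xs ⟨i, hi⟩ = xs ⟨j, hj⟩ :=
  Iff.rfl

theorem snoc_mk_lt {α : Type*} {m i : ℕ} (hi : i < m) (hi' : i < m + 1) (xs : Fin m → α) (x : α) :
    (Fin.snoc xs x : Fin (m + 1) → α) ⟨i, hi'⟩ = xs ⟨i, hi⟩ := by
  simp [Fin.snoc, hi]

theorem snoc_mk_self {α : Type*} {m : ℕ} (hi : m < m + 1) (xs : Fin m → α) (x : α) :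
    (Fin.snoc xs x : Fin (m + 1) → α) ⟨m, hi⟩ = x := by
  simp [Fin.snoc]

end Definability

/-! ### Transitive models of set theory -/

/-- `M` is a transitive model of ZFC. -/
class IsTransitiveModel (M : Set ZFSet.{u}) : Prop where
  mem_trans : ∀ x ∈ M, ∀ y ∈ x, y ∈ M
  models : M ⊨ ZFC

section Model

variable {M : Set ZFSet.{u}} [hM : IsTransitiveModel M]

variable {Γ : Type (u + 1)} [Ctx M Γ]

theorem mem_model {x y : ZFSet.{u}} (hx : x ∈ M) (hy : y ∈ x) : y ∈ M :=
  hM.mem_trans x hx y hy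

theorem ext_model' {x y : ZFSet.{u}} (hx : ∀ z ∈ x, z ∈ M) (hy : y ∈ M)
    (h : ∀ z ∈ M, z ∈ x ↔ z ∈ y) : x = y :=
  ZFSet.ext fun z => ⟨fun hz => (h z (hx z hz)).1 hz, fun hz => (h z (mem_model hy hz)).2 hz⟩

theorem ext_model {x y : ZFSet.{u}} (hx : x ∈ M) (hy : y ∈ M)
    (h : ∀ z ∈ M, z ∈ x ↔ z ∈ y) : x = y :=
  ZFSet.ext fun z => ⟨fun hz => (h z (mem_model hx hz)).1 hz, fun hz => (h z (mem_model hy hz)).2 hz⟩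

instance DefPred.exists_mem (p : Γ → ZFSet.{u} → Prop) (f : Γ → ZFSet.{u}) [hf : DefFun M f]
    [hp : DefPred M (fun δ : Γ × M => p δ.1 δ.2)] : DefPred M (fun γ => ∃ x ∈ f γ, p γ x) :=
  have := hf.weaken (fun δ : Γ × M => δ.1)
  DefPred.congr (inferInstance : DefPred M (fun γ => ∃ x ∈ M, x ∈ f γ ∧ p γ x)) fun γ =>
    ⟨fun ⟨x, _, h⟩ => ⟨x, h⟩, fun ⟨x, h⟩ => ⟨x, mem_model (hf.mem γ) h.1, h⟩⟩

instance DefPred.forall_mem (p : Γ → ZFSet.{u} → Prop) (f : Γ → ZFSet.{u}) [hf : DefFun M f]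
    [hp : DefPred M (fun δ : Γ × M => p δ.1 δ.2)] : DefPred M (fun γ => ∀ x ∈ f γ, p γ x) :=
  DefPred.congr (inferInstance : DefPred M (fun γ => ¬ ∃ x ∈ f γ, ¬ p γ x)) fun γ => by
    push Not; rfl

instance DefPred.subset (f g : Γ → ZFSet.{u}) [hf : DefFun M f] [hg : DefFun M g] :
    DefPred M (fun γ => f γ ⊆ g γ) :=
  have := hg.weaken (fun δ : Γ × M => δ.1)
  DefPred.congr (inferInstance : DefPred M (fun γ => ∀ x ∈ f γ, x ∈ g γ)) fun _ => Iff.rfl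

/-- A definable function is determined by the definable predicate that describes the elements of
its values. -/
theorem DefFun.of_mem {f : Γ → ZFSet.{u}} (hf : ∀ γ, f γ ∈ M) (p : Γ → ZFSet.{u} → Prop)
    [hp : DefPred M (fun δ : Γ × M => p δ.1 δ.2)] (h : ∀ γ, ∀ x ∈ M, x ∈ f γ ↔ p γ x) :
    DefFun M f := by
  have := IsWeakening.prodMap M (fun δ : Γ × M => δ.1)
  have := hp.weaken (fun δ : (Γ × M) × M => (δ.1.1, δ.2))
  refine DefFun.of_graph hf (fun γ y => ∀ x ∈ M, x ∈ y ↔ p γ x) fun γ y hy => ?_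
  constructor
  · exact fun H => ext_model hy (hf γ) fun z hz => (H z hz).trans (h γ z hz).symm
  · rintro rfl
    exact h γ

theorem exists_sep_of_formula {n : ℕ} (φ : setLang.Formula (Fin (n + 1))) (p : Fin n → M) (a : M) :
    ∃ b : M, ∀ x : M, (x : ZFSet.{u}) ∈ (b : ZFSet.{u}) ↔ (x : ZFSet.{u}) ∈ (a : ZFSet.{u}) ∧
      φ.Realize (fun k => if h : (k : ℕ) < n then p ⟨k, h⟩ else x) := by
  have h : M ⊨ axSeparation φ :=
    hM.models.realize_of_mem _ (Or.inl (Or.inr ⟨n, φ, rfl⟩))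
  rw [axSeparation, Language.Sentence.Realize,
    Language.BoundedFormula.realize_alls] at h
  have := h p
  simp only [Language.BoundedFormula.realize_all, Language.BoundedFormula.realize_ex] at this
  obtain ⟨b, hb⟩ := this a
  refine ⟨b, fun x => ?_⟩
  have := hb x
  simp only [inst₁, Language.BoundedFormula.realize_iff, realize_vMem,
    Language.BoundedFormula.realize_inf, Language.BoundedFormula.realize_relabel] at this
  rw [snoc_mk_self, snoc_mk_lt (by omega), snoc_mk_self, snoc_mk_lt (by omega),
    snoc_mk_lt (by omega), snoc_mk_self] at this
  rw [this, Language.Formula.Realize]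
  refine and_congr_right fun _ => iff_of_eq ?_
  congr 1
  · funext k
    by_cases hk : (k : ℕ) < n
    · simp [hk, Fin.snoc, Nat.lt_succ_of_lt hk, show (k : ℕ) < n + 2 by omega]
      rfl
    · simp [hk, Fin.snoc]
  · exact Subsingleton.elim _ _

theorem sep_mem_model {p : Γ × M → Prop} (hp : DefPred M p) (γ : Γ) {a : ZFSet.{u}} (ha : a ∈ M) :
    ZFSet.sep (fun x => ∃ h : x ∈ M, p (γ, ⟨x, h⟩)) a ∈ M := by
  classical
  obtain ⟨φ, hφ⟩ := hp
  let n := Fintype.card φ.freeVarFinset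
  let e : φ.freeVarFinset ≃ Fin n := Fintype.equivFin _
  let f : φ.freeVarFinset → Fin (n + 1) := fun v =>
    if v.1.1 = Prod.snd then Fin.last n else (e v).castSucc
  -- The value of `x` is irrelevant for the parameters, so `a` is used in its place.
  obtain ⟨b, hb⟩ := exists_sep_of_formula (φ.restrictFreeVar f)
    (fun i => (e.symm i).1.1 (γ, ⟨a, ha⟩)) ⟨a, ha⟩
  convert b.2
  refine ext_model' (fun z hz => mem_model ha (ZFSet.mem_sep.1 hz).1) b.2 fun x hx => ?_
  rw [ZFSet.mem_sep]
  refine Iff.trans (and_congr_right fun _ => ?_) (hb ⟨x, hx⟩).symm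
  rw [exists_prop_of_true hx, ← hφ]
  refine (Language.BoundedFormula.realize_restrictFreeVar _ ?_).symm
  intro v
  by_cases hv : v.1.1 = Prod.snd
  · simp [f, hv]
  · obtain h | ⟨w, _, h⟩ := v.1.2
    · exact absurd h hv
    · have h1 : ∀ y, v.1.1 (γ, y) = w γ := fun y => by rw [← h]; rfl
      simp [f, hv, h1]

instance DefFun.sep (p : Γ → ZFSet.{u} → Prop) (f : Γ → ZFSet.{u})
    [hp : DefPred M (fun δ : Γ × M => p δ.1 δ.2)] [hf : DefFun M f] :
    DefFun M (fun γ => ZFSet.sep (p γ) (f γ)) := by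
  have := hf.weaken (fun δ : Γ × M => δ.1)
  refine DefFun.of_mem (fun γ => ?_) (fun γ x => x ∈ f γ ∧ p γ x) fun _ _ _ => ZFSet.mem_sep
  convert sep_mem_model hp γ (hf.mem γ) using 1
  ext x
  simp only [ZFSet.mem_sep]
  exact and_congr_right fun hx => ⟨fun h => ⟨mem_model (hf.mem γ) hx, h⟩, fun ⟨_, h⟩ => h⟩

theorem pair_set_mem_model {a b : ZFSet.{u}} (ha : a ∈ M) (hb : b ∈ M) :
    ({a, b} : ZFSet.{u}) ∈ M := by
  have h : M ⊨ axPairing := hM.models.realize_of_mem _ (by simp [ZFC])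
  simp [axPairing, Language.Sentence.Realize, Language.Formula.Realize, Fin.snoc] at h
  obtain ⟨c, hc, h⟩ := h a ha b hb
  rwa [ext_model' (x := {a, b}) (by simp [ha, hb]) hc fun z hz => by simp [h z hz] ]

theorem sUnion_mem_model {a : ZFSet.{u}} (ha : a ∈ M) : (ZFSet.sUnion a : ZFSet.{u}) ∈ M := by
  have h : M ⊨ axUnion := hM.models.realize_of_mem _ (by simp [ZFC])
  simp [axUnion, Language.Sentence.Realize, Language.Formula.Realize, Fin.snoc] at h
  obtain ⟨c, hc, h⟩ := h a ha
  rwa [ext_model' (x := ZFSet.sUnion a) (fun z hz => ?_) hc fun z hz => ?_]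
  · obtain ⟨y, hy, hz⟩ := ZFSet.mem_sUnion.1 hz
    exact mem_model (mem_model ha hy) hz
  · rw [h z hz, ZFSet.mem_sUnion]
    exact ⟨fun ⟨y, hy, hz⟩ => ⟨y, hy, mem_model ha hy, hz⟩, fun ⟨y, hy, _, hz⟩ => ⟨y, hy, hz⟩⟩

variable (M) in
/-- The power set as computed in `M`. -/
noncomputable def powersetIn (a : ZFSet.{u}) : ZFSet.{u} :=
  ZFSet.sep (fun x => x ∈ M) (ZFSet.powerset a)

omit hM in
@[simp]
theorem mem_powersetIn {a x : ZFSet.{u}} : x ∈ powersetIn M a ↔ x ⊆ a ∧ x ∈ M := by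
  simp [powersetIn]

theorem powersetIn_mem_model {a : ZFSet.{u}} (ha : a ∈ M) : powersetIn M a ∈ M := by
  have h : M ⊨ axPowerset := hM.models.realize_of_mem _ (by simp [ZFC])
  simp [axPowerset, Language.Sentence.Realize, Language.Formula.Realize, Fin.snoc] at h
  obtain ⟨c, hc, h⟩ := h a ha
  rwa [ext_model' (x := powersetIn M a) (fun z hz => (mem_powersetIn.1 hz).2) hc fun z hz => ?_]
  rw [h z hz, mem_powersetIn]
  exact ⟨fun H y _ hy => H.1 hy, fun H => ⟨fun y hy => H y (mem_model hz hy) hy, hz⟩⟩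

instance DefFun.pairSet (f g : Γ → ZFSet.{u}) [hf : DefFun M f] [hg : DefFun M g] :
    DefFun M (fun γ => ({f γ, g γ} : ZFSet.{u})) :=
  have := hf.weaken (fun δ : Γ × M => δ.1)
  have := hg.weaken (fun δ : Γ × M => δ.1)
  DefFun.of_mem (fun γ => pair_set_mem_model (hf.mem γ) (hg.mem γ))
    (fun γ x => x = f γ ∨ x = g γ) fun _ _ _ => ZFSet.mem_pair

instance DefFun.singleton (f : Γ → ZFSet.{u}) [hf : DefFun M f] :
    DefFun M (fun γ => ({f γ} : ZFSet.{u})) := by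
  simpa using DefFun.pairSet (M := M) f f

instance DefFun.pair (f g : Γ → ZFSet.{u}) [hf : DefFun M f] [hg : DefFun M g] :
    DefFun M (fun γ => ZFSet.pair (f γ) (g γ)) :=
  (inferInstance : DefFun M (fun γ => ({{f γ}, {f γ, g γ}} : ZFSet.{u})))

instance DefFun.sUnion (f : Γ → ZFSet.{u}) [hf : DefFun M f] :
    DefFun M (fun γ => (ZFSet.sUnion (f γ) : ZFSet.{u})) :=
  have := hf.weaken (fun δ : Γ × M => δ.1)
  DefFun.of_mem (fun γ => sUnion_mem_model (hf.mem γ)) (fun γ x => ∃ y ∈ f γ, x ∈ y)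
    fun _ _ _ => ZFSet.mem_sUnion

instance DefFun.union (f g : Γ → ZFSet.{u}) [hf : DefFun M f] [hg : DefFun M g] :
    DefFun M (fun γ => f γ ∪ g γ) :=
  (inferInstance : DefFun M (fun γ => (ZFSet.sUnion {f γ, g γ} : ZFSet.{u})))

instance DefFun.powersetIn (f : Γ → ZFSet.{u}) [hf : DefFun M f] :
    DefFun M (fun γ => powersetIn M (f γ)) :=
  have := hf.weaken (fun δ : Γ × M => δ.1)
  DefFun.of_mem (fun γ => powersetIn_mem_model (hf.mem γ)) (fun γ x => x ⊆ f γ)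
    fun γ x hx => by simp [hx]

theorem prod_mem_model {a b : ZFSet.{u}} (ha : a ∈ M) (hb : b ∈ M) : a.prod b ∈ M := by
  have : InM M a := ⟨ha⟩
  have : InM M b := ⟨hb⟩
  convert DefFun.mem_of_const (M := M) (c := ZFSet.sep (fun z => ∃ x ∈ a, ∃ y ∈ b, z = ZFSet.pair x y)
    (powersetIn M (powersetIn M (a ∪ b)))) inferInstance using 1
  ext z
  simp only [ZFSet.mem_prod, ZFSet.mem_sep, mem_powersetIn]
  refine ⟨fun h => ⟨?_, h⟩, fun h => h.2⟩
  obtain ⟨x, hx, y, hy, rfl⟩ := h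
  have hx' := mem_model ha hx
  have hy' := mem_model hb hy
  have : InM M x := ⟨hx'⟩
  have : InM M y := ⟨hy'⟩
  have h1 : ({x} : ZFSet.{u}) ∈ M := DefFun.mem_of_const inferInstance
  have h2 : ({x, y} : ZFSet.{u}) ∈ M := DefFun.mem_of_const inferInstance
  refine ⟨fun w hw => ?_, DefFun.mem_of_const (c := ZFSet.pair x y) inferInstance⟩
  rw [ZFSet.pair, ZFSet.mem_pair] at hw
  rw [mem_powersetIn]
  obtain rfl | rfl := hw
  · exact ⟨fun v hv => by simp at hv; simp [hv, hx], h1⟩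
  · exact ⟨fun v hv => by simp at hv; obtain rfl | rfl := hv <;> simp [hx, hy], h2⟩

/-- The ordinals in a set given by the axiom of infinity are upward directed under `∈`. They serve
as ranks in inductive constructions inside `M`. -/
theorem exists_directed_mem_model : ∃ D ∈ M, D.Nonempty ∧
    ∀ i ∈ D, ∀ j ∈ D, ∃ k ∈ D, i ∈ k ∧ j ∈ k := by
  have h : M ⊨ axInfinity := hM.models.realize_of_mem _ (by simp [ZFC])
  simp [axInfinity, Language.Sentence.Realize, Language.Formula.Realize, Fin.snoc] at h
  obtain ⟨I, ⟨e, he, heM, he'⟩, hI, hs⟩ := h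
  have : InM M I := ⟨hI⟩
  have hord : ∀ x : ZFSet.{u}, x.IsOrdinal ↔
      (∀ y ∈ x, y ⊆ x) ∧ ∀ y ∈ x, ∀ z ∈ y, z ⊆ y := by
    intro x
    rw [ZFSet.isOrdinal_iff_forall_mem_isTransitive]
    rfl
  have hsucc : ∀ i ∈ I, insert i i ∈ I := by
    intro i hi
    obtain ⟨k, hk, hkM, hk'⟩ := hs i (mem_model hI hi) hi
    convert hk
    refine ext_model' (fun z hz => ?_) hkM fun z hz => ?_
    · obtain rfl | hz := ZFSet.mem_insert_iff.1 hz
      exacts [mem_model hI hi, mem_model (mem_model hI hi) hz]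
    · rw [hk' z hz, ZFSet.mem_insert_iff, or_comm]
  refine ⟨ZFSet.sep (fun x => (∀ y ∈ x, y ⊆ x) ∧ ∀ y ∈ x, ∀ z ∈ y, z ⊆ y) I,
    DefFun.mem_of_const inferInstance, ⟨∅, ?_⟩, fun i hi j hj => ?_⟩
  · have : e = ∅ := (ZFSet.eq_empty e).2 fun y hy => he' y (mem_model heM hy) hy
    simp [← this, he]
    simp [this]
  · simp only [ZFSet.mem_sep, ← hord] at hi hj ⊢
    obtain h | h | h := hi.2.mem_trichotomous hj.2
    · exact ⟨_, ⟨hsucc j hj.1, ZFSet.isOrdinal_succ hj.2⟩, by simp [h], by simp⟩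
    · exact ⟨_, ⟨hsucc j hj.1, ZFSet.isOrdinal_succ hj.2⟩, by simp [h], by simp⟩
    · exact ⟨_, ⟨hsucc i hi.1, ZFSet.isOrdinal_succ hi.2⟩, by simp, by simp [h]⟩

/-- The axiom of choice in `M`: a relation in `M` is uniformized by a function in `M`. -/
theorem exists_uniformization_mem_model {X ρ : ZFSet.{u}} (hX : X ∈ M) (hρ : ρ ∈ M)
    (hρX : ρ ⊆ X.prod X) :
    ∃ C ∈ M, ∀ x y, ZFSet.pair x y ∈ ρ →
      ∃ z, (ZFSet.pair x z ∈ C ∧ ZFSet.pair x z ∈ ρ) ∧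
        ∀ z', ZFSet.pair x z' ∈ C → ZFSet.pair x z' ∈ ρ → z' = z := by
  have h : M ⊨ axChoice := hM.models.realize_of_mem _ (by simp [ZFC])
  simp [axChoice, Language.Sentence.Realize, Language.Formula.Realize, Fin.snoc] at h
  have : InM M X := ⟨hX⟩
  have : InM M ρ := ⟨hρ⟩
  -- The fibres of `ρ` are pairwise disjoint.
  let fib : ZFSet.{u} → ZFSet.{u} := fun x => ZFSet.sep (fun z => ∃ y ∈ X, z = ZFSet.pair x y) ρ
  have hfib : ∀ {x z}, z ∈ fib x ↔ z ∈ ρ ∧ ∃ y ∈ X, z = ZFSet.pair x y := ZFSet.mem_sep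
  have hfibM : ∀ x ∈ X, fib x ∈ M := fun x hx =>
    have : InM M x := ⟨mem_model hX hx⟩
    DefFun.mem_of_const inferInstance
  let A := ZFSet.sep (fun a => ∃ x ∈ X, (∃ y ∈ X, ZFSet.pair x y ∈ ρ) ∧
    a = ZFSet.sep (fun z => ∃ y ∈ X, z = ZFSet.pair x y) ρ) (powersetIn M ρ)
  have hA : ∀ {a}, a ∈ A ↔ a ∈ powersetIn M ρ ∧
    ∃ x ∈ X, (∃ y ∈ X, ZFSet.pair x y ∈ ρ) ∧ a = fib x := ZFSet.mem_sep
  have hAM : A ∈ M := DefFun.mem_of_const inferInstance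
  have hne : ∀ a ∈ M, a ∈ A → ∃ z ∈ M, z ∈ a := by
    rintro a - ha
    obtain ⟨-, x, hx, ⟨y, hy, hxy⟩, rfl⟩ := hA.1 ha
    exact ⟨_, mem_model hρ hxy, hfib.2 ⟨hxy, y, hy, rfl⟩⟩
  have hdisj : ∀ a ∈ M, ∀ b ∈ M, a ∈ A → b ∈ A → ∀ z ∈ a, z ∈ M → z ∈ b → a = b := by
    rintro a - b - ha hb z hza - hzb
    obtain ⟨-, x, hx, -, rfl⟩ := hA.1 ha
    obtain ⟨-, x', hx', -, rfl⟩ := hA.1 hb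
    obtain ⟨-, y, -, rfl⟩ := hfib.1 hza
    obtain ⟨-, y', -, h⟩ := hfib.1 hzb
    rw [(ZFSet.pair_inj.1 h).1]
  obtain ⟨C, hC, h⟩ := h A hAM hne hdisj
  refine ⟨C, hC, fun x y hxy => ?_⟩
  obtain ⟨hx, hy⟩ := ZFSet.pair_mem_prod.1 (hρX hxy)
  obtain ⟨z, ⟨hz, hzC⟩, -, hz'⟩ := h (fib x) (hfibM x hx) (hA.2
    ⟨mem_powersetIn.2 ⟨ZFSet.sep_subset, hfibM x hx⟩, x, hx, ⟨y, hy, hxy⟩, rfl⟩)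
  obtain ⟨hzρ, w, hw, rfl⟩ := hfib.1 hz
  refine ⟨w, ⟨hzC, hzρ⟩, fun w' hw' hw'ρ => ?_⟩
  exact (ZFSet.pair_inj.1 (hz' _ (mem_model hρ hw'ρ) (hfib.2
    ⟨hw'ρ, w', (ZFSet.pair_mem_prod.1 (hρX hw'ρ)).2, rfl⟩) hw')).2

end Model
end LocaleInterpretation

namespace LocaleInterpretation

/-! ### Zorn's lemma inside a model -/

section Zorn

variable {M : Set ZFSet.{u}}

variable (M) in
/-- `T` contains `x₀` and is closed under the relation `σ` and under unions of nonempty chains that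
are elements of `M`. -/
abbrev IsTower (X σ x₀ T : ZFSet.{u}) : Prop :=
  x₀ ∈ T ∧ (∀ K ∈ T, ∀ z ∈ X, ZFSet.pair K z ∈ σ → z ∈ T) ∧
    ∀ 𝒞 ∈ M, 𝒞 ⊆ T → (∃ c ∈ M, c ∈ 𝒞) → (∀ a ∈ 𝒞, ∀ b ∈ 𝒞, a ⊆ b ∨ b ⊆ a) →
      (ZFSet.sUnion 𝒞 : ZFSet.{u}) ∈ T

set_option synthInstance.maxSize 2000 in
/-- Zorn's lemma in `M`, for a set ordered by inclusion and closed under unions of nonempty chains.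
If there were no maximal element, the axiom of choice in `M` would give a function `g` with
`J ⊊ g J`; the least tower for `g` is a chain, and its union contradicts this. -/
theorem exists_maximal_mem_model [hM : IsTransitiveModel M] {X : ZFSet.{u}} (hX : X ∈ M)
    (hne : X.Nonempty)
    (hchain : ∀ 𝒞 ∈ M, 𝒞 ⊆ X → (∃ c ∈ M, c ∈ 𝒞) → (∀ a ∈ 𝒞, ∀ b ∈ 𝒞, a ⊆ b ∨ b ⊆ a) →
      (ZFSet.sUnion 𝒞 : ZFSet.{u}) ∈ X) :
    ∃ K ∈ X, ∀ J ∈ X, K ⊆ J → J = K := by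
  by_contra! hmax
  obtain ⟨x₀, hx₀⟩ := hne
  have hx₀X : x₀ ∈ X := hx₀
  have hXX := prod_mem_model hX hX
  have : InM M X := ⟨hX⟩
  have : InM M x₀ := ⟨mem_model hX hx₀⟩
  have : InM M (X.prod X) := ⟨hXX⟩
  let ρ := ZFSet.sep (fun z => ∃ J ∈ X, ∃ K ∈ X, z = ZFSet.pair J K ∧ J ⊆ K ∧ ¬ K = J) (X.prod X)
  have hρM : ρ ∈ M := DefFun.mem_of_const inferInstance
  have hρ : ∀ {J K}, ZFSet.pair J K ∈ ρ ↔ J ∈ X ∧ K ∈ X ∧ J ⊆ K ∧ ¬ K = J := by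
    intro J K
    simp only [ρ, ZFSet.mem_sep, ZFSet.pair_mem_prod, ZFSet.pair_inj]
    constructor
    · rintro ⟨-, J, hJ, K, hK, ⟨rfl, rfl⟩, h⟩
      exact ⟨hJ, hK, h⟩
    · rintro ⟨hJ, hK, h⟩
      exact ⟨⟨hJ, hK⟩, J, hJ, K, hK, ⟨rfl, rfl⟩, h⟩
  obtain ⟨C, hC, hCρ⟩ := exists_uniformization_mem_model hX hρM ZFSet.sep_subset
  have : InM M C := ⟨hC⟩
  have : InM M ρ := ⟨hρM⟩
  let σ := ZFSet.sep (fun z => z ∈ C) ρ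
  have hσM : σ ∈ M := DefFun.mem_of_const inferInstance
  have : InM M σ := ⟨hσM⟩
  have hg : ∀ J, ∃ K, J ∈ X → K ∈ X ∧ J ⊆ K ∧ ¬ K = J ∧ ∀ z, ZFSet.pair J z ∈ σ ↔ z = K := by
    intro J
    by_cases hJ : J ∈ X
    · obtain ⟨K, hK, hJK, hne⟩ := hmax J hJ
      obtain ⟨z, ⟨hzC, hzρ⟩, hz⟩ := hCρ J K (hρ.2 ⟨hJ, hK, hJK, hne⟩)
      obtain ⟨-, hzX, hJz, hne⟩ := hρ.1 hzρ
      refine ⟨z, fun _ => ⟨hzX, hJz, hne, fun w => ⟨fun hw => ?_, ?_⟩⟩⟩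
      · exact hz w (ZFSet.mem_sep.1 hw).2 (ZFSet.mem_sep.1 hw).1
      · rintro rfl
        exact ZFSet.mem_sep.2 ⟨hzρ, hzC⟩
    · exact ⟨∅, fun h => absurd h hJ⟩
  choose g hg using hg
  let T₀ := ZFSet.sep (fun x => ∀ T ∈ M, T ⊆ X → IsTower M X σ x₀ T → x ∈ T) X
  have hT₀M : T₀ ∈ M := DefFun.mem_of_const inferInstance
  have : InM M T₀ := ⟨hT₀M⟩
  have hT₀X : T₀ ⊆ X := ZFSet.sep_subset
  have hx₀T : x₀ ∈ T₀ := ZFSet.mem_sep.2 ⟨hx₀, fun T _ _ h => h.1⟩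
  have hgT : ∀ K ∈ T₀, g K ∈ T₀ := fun K hK => by
    obtain ⟨hKX, hKT⟩ := ZFSet.mem_sep.1 hK
    exact ZFSet.mem_sep.2 ⟨(hg K hKX).1, fun T hTM hTX hT =>
      hT.2.1 K (hKT T hTM hTX hT) _ (hg K hKX).1 (((hg K hKX).2.2.2 _).2 rfl)⟩
  have hUT : ∀ 𝒞 ∈ M, 𝒞 ⊆ T₀ → (∃ c ∈ M, c ∈ 𝒞) → (∀ a ∈ 𝒞, ∀ b ∈ 𝒞, a ⊆ b ∨ b ⊆ a) →
      (ZFSet.sUnion 𝒞 : ZFSet.{u}) ∈ T₀ := fun 𝒞 h𝒞 hsub hne hch =>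
    ZFSet.mem_sep.2 ⟨hchain 𝒞 h𝒞 (fun c hc => hT₀X (hsub hc)) hne hch, fun T hTM hTX hT =>
      hT.2.2 𝒞 h𝒞 (fun c hc => (ZFSet.mem_sep.1 (hsub hc)).2 T hTM hTX hT) hne hch⟩
  -- The induction principle for the least tower, restricted to definable predicates.
  have hind : ∀ (p : ZFSet.{u} → Prop) [DefPred M (fun δ : PUnit × M => p δ.2)], p x₀ →
      (∀ K ∈ T₀, p K → p (g K)) →
      (∀ 𝒞 ∈ M, 𝒞 ⊆ T₀ → (∃ c ∈ M, c ∈ 𝒞) → (∀ a ∈ 𝒞, ∀ b ∈ 𝒞, a ⊆ b ∨ b ⊆ a) →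
        (∀ c ∈ 𝒞, p c) → p (ZFSet.sUnion 𝒞 : ZFSet.{u})) → ∀ x ∈ T₀, p x := by
    intro p _ h0 hs hU x hx
    refine (ZFSet.mem_sep.1 ((ZFSet.mem_sep.1 hx).2 (ZFSet.sep p T₀)
      (DefFun.mem_of_const inferInstance) (fun y hy => hT₀X (ZFSet.sep_subset hy)) ⟨?_, ?_, ?_⟩)).2
    · exact ZFSet.mem_sep.2 ⟨hx₀T, h0⟩
    · intro K hK z hz hKz
      obtain ⟨hK, hpK⟩ := ZFSet.mem_sep.1 hK
      obtain rfl := ((hg K (hT₀X hK)).2.2.2 z).1 hKz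
      exact ZFSet.mem_sep.2 ⟨hgT K hK, hs K hK hpK⟩
    · intro 𝒞 h𝒞 hsub hne hch
      have hsub' : 𝒞 ⊆ T₀ := fun c hc => ZFSet.sep_subset (hsub hc)
      exact ZFSet.mem_sep.2 ⟨hUT 𝒞 h𝒞 hsub' hne hch,
        hU 𝒞 h𝒞 hsub' hne hch fun c hc => (ZFSet.mem_sep.1 (hsub hc)).2⟩
  have hx₀le : ∀ x ∈ T₀, x₀ ⊆ x := by
    refine hind (fun x => x₀ ⊆ x) (fun _ h => h) (fun K hK h y hy =>
      (hg K (hT₀X hK)).2.1 (h hy)) ?_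
    rintro 𝒞 - - ⟨c, -, hc⟩ - h y hy
    exact ZFSet.mem_sUnion_of_mem (h c hc hy) hc
  -- `E e` says that `g y ⊆ e` whenever `y ⊊ e`. Every such `e` is comparable with all members of
  -- `T₀`, and this in turn shows that all members of `T₀` satisfy `E`.
  let E : ZFSet.{u} → Prop := fun e =>
    ∀ y ∈ T₀, y ⊆ e → ¬ y = e → ∀ z ∈ X, ZFSet.pair y z ∈ σ → z ⊆ e
  have hEdef : DefPred M (fun δ : PUnit × M => E δ.2) :=
    (inferInstance : DefPred M (fun δ : PUnit × M => ∀ y ∈ T₀, y ⊆ (δ.2 : ZFSet.{u}) →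
      ¬ y = (δ.2 : ZFSet.{u}) → ∀ z ∈ X, ZFSet.pair y z ∈ σ → z ⊆ (δ.2 : ZFSet.{u})))
  have hE : ∀ e, E e → ∀ y ∈ T₀, y ⊆ e → ¬ y = e → g y ⊆ e := fun e he y hy hye hne =>
    he y hy hye hne _ (hg y (hT₀X hy)).1 (((hg y (hT₀X hy)).2.2.2 _).2 rfl)
  have hcomp : ∀ e ∈ T₀, E e → ∀ y ∈ T₀, y ⊆ e ∨ g e ⊆ y := by
    intro e he hEe
    have : InM M e := ⟨mem_model hT₀M he⟩
    have : InM M (g e) := ⟨mem_model hX (hg e (hT₀X he)).1⟩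
    refine hind (fun y => y ⊆ e ∨ g e ⊆ y) (Or.inl (hx₀le e he)) ?_ ?_
    · rintro y hy (h | h)
      · by_cases hye : y = e
        · exact Or.inr (hye ▸ fun _ h => h)
        · exact Or.inl (hE e hEe y hy h hye)
      · exact Or.inr fun w hw => (hg y (hT₀X hy)).2.1 (h hw)
    · intro 𝒞 h𝒞 hsub hne hch h
      by_cases hall : ∀ c ∈ 𝒞, c ⊆ e
      · left
        intro w hw
        obtain ⟨c, hc, hw⟩ := ZFSet.mem_sUnion.1 hw
        exact hall c hc hw
      · push Not at hall
        obtain ⟨c, hc, hce⟩ := hall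
        exact Or.inr fun w hw => ZFSet.mem_sUnion_of_mem ((h c hc).resolve_left hce hw) hc
  have hext : ∀ e ∈ T₀, E e := by
    refine hind E ?_ ?_ ?_
    · intro y hy hle hne
      exact absurd (subset_antisymm hle (hx₀le y hy)) hne
    · intro e he hEe y hy hle hne z hz hyz
      obtain rfl := ((hg y (hT₀X hy)).2.2.2 z).1 hyz
      obtain h | h := hcomp e he hEe y hy
      · by_cases hye : y = e
        · rw [hye]
        · exact fun w hw => (hg e (hT₀X he)).2.1 (hE e hEe y hy h hye hw)
      · exact absurd (subset_antisymm hle h) hne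
    · intro 𝒞 h𝒞 hsub hne hch hall y hy hle hyne z hz hyz
      obtain rfl := ((hg y (hT₀X hy)).2.2.2 z).1 hyz
      obtain ⟨c, hc, hcy⟩ : ∃ c ∈ 𝒞, ¬ c ⊆ y := by
        by_contra! h
        refine hyne (subset_antisymm hle fun w hw => ?_)
        obtain ⟨c, hc, hw⟩ := ZFSet.mem_sUnion.1 hw
        exact h c hc hw
      have hyc : y ⊆ c := (hcomp c (hsub hc) (hall c hc) y hy).resolve_right fun h =>
        hcy fun w hw => h ((hg c (hT₀X (hsub hc))).2.1 hw)
      have hne' : ¬ y = c := by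
        rintro rfl
        exact hcy fun _ h => h
      exact fun w hw => ZFSet.mem_sUnion_of_mem (hE c (hall c hc) y hy hyc hne' hw) hc
  have htop := hUT T₀ hT₀M (fun _ h => h) ⟨x₀, mem_model hX hx₀, hx₀T⟩ fun a ha b hb => by
    obtain h | h := hcomp b hb (hext b hb) a ha
    · exact Or.inl h
    · exact Or.inr fun w hw => h ((hg b (hT₀X hb)).2.1 hw)
  obtain ⟨-, hle, hne, -⟩ := hg _ (hT₀X htop)
  exact hne (subset_antisymm (fun w hw => ZFSet.mem_sUnion_of_mem hw (hgT _ htop)) hle)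

end Zorn

end LocaleInterpretation

namespace LocaleInterpretation

/-! ### Prime ideals in a model -/

section Ring

variable {M : Set ZFSet.{u}} (R : RingIn M)

/-- The graph of the addition of `R`. -/
noncomputable def RingIn.addGraph : ZFSet.{u} :=
  ZFSet.range (fun p : R.carrier × R.carrier =>
    ZFSet.pair (ZFSet.pair p.1 p.2) (p.1 + p.2 : R.carrier))

/-- The graph of the multiplication of `R`. -/
noncomputable def RingIn.mulGraph : ZFSet.{u} :=
  ZFSet.range (fun p : R.carrier × R.carrier =>
    ZFSet.pair (ZFSet.pair p.1 p.2) (p.1 * p.2 : R.carrier))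

variable {R}

@[simp]
theorem mem_addGraph {x y z : R.carrier} :
    ZFSet.pair (ZFSet.pair x y) z ∈ R.addGraph ↔ x + y = z := by
  simp only [RingIn.addGraph, ZFSet.mem_range, ZFSet.pair_inj, Prod.exists]
  constructor
  · rintro ⟨a, b, ⟨ha, hb⟩, h⟩
    obtain rfl := Subtype.ext ha
    obtain rfl := Subtype.ext hb
    exact Subtype.ext h
  · rintro rfl
    exact ⟨x, y, ⟨rfl, rfl⟩, rfl⟩

@[simp]
theorem mem_mulGraph {x y z : R.carrier} :
    ZFSet.pair (ZFSet.pair x y) z ∈ R.mulGraph ↔ x * y = z := by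
  simp only [RingIn.mulGraph, ZFSet.mem_range, ZFSet.pair_inj, Prod.exists]
  constructor
  · rintro ⟨a, b, ⟨ha, hb⟩, h⟩
    obtain rfl := Subtype.ext ha
    obtain rfl := Subtype.ext hb
    exact Subtype.ext h
  · rintro rfl
    exact ⟨x, y, ⟨rfl, rfl⟩, rfl⟩

instance : InM M R.carrier := ⟨R.carrier_mem⟩

instance : InM M R.addGraph := ⟨R.add_mem⟩

instance : InM M R.mulGraph := ⟨R.mul_mem⟩

instance [IsTransitiveModel M] (x : R.carrier) : InM M (x : ZFSet.{u}) :=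
  ⟨mem_model R.carrier_mem x.2⟩

variable (R) in
/-- The set `J` is closed under the operations of an ideal of `R`. -/
abbrev IsIdealSet (J : ZFSet.{u}) : Prop :=
  ((0 : R.carrier) : ZFSet.{u}) ∈ J ∧
  (∀ x ∈ J, ∀ y ∈ J, ∀ z ∈ R.carrier, ZFSet.pair (ZFSet.pair x y) z ∈ R.addGraph → z ∈ J) ∧
  ∀ r ∈ R.carrier, ∀ x ∈ J, ∀ z ∈ R.carrier, ZFSet.pair (ZFSet.pair r x) z ∈ R.mulGraph → z ∈ J

/-- The ideal whose underlying set is `J`. -/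
def IsIdealSet.toIdeal {J : ZFSet.{u}} (h : IsIdealSet R J) : Ideal R.carrier where
  carrier := {x | (x : ZFSet.{u}) ∈ J}
  zero_mem' := h.1
  add_mem' {x y} hx hy := h.2.1 x hx y hy _ (x + y).2 (mem_addGraph.2 rfl)
  smul_mem' r x hx := h.2.2 r r.2 x hx _ (r * x).2 (mem_mulGraph.2 rfl)

variable (R) in
/-- The underlying set of an ideal. -/
noncomputable def idealSet (I : Ideal R.carrier) : ZFSet.{u} :=
  ZFSet.range (fun a : I => ((a : R.carrier) : ZFSet.{u}))

theorem coe_mem_idealSet {I : Ideal R.carrier} {x : R.carrier} :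
    (x : ZFSet.{u}) ∈ idealSet R I ↔ x ∈ I := by
  simp only [idealSet, ZFSet.mem_range]
  exact ⟨fun ⟨y, hy⟩ => Subtype.ext hy ▸ y.2, fun h => ⟨⟨x, h⟩, rfl⟩⟩

theorem idealSet_subset (I : Ideal R.carrier) : idealSet R I ⊆ R.carrier := by
  intro x hx
  obtain ⟨y, rfl⟩ := ZFSet.mem_range.1 hx
  exact y.1.2

theorem ext_of_subset_carrier {A B : ZFSet.{u}} (hA : A ⊆ R.carrier) (hB : B ⊆ R.carrier)
    (h : ∀ x : R.carrier, (x : ZFSet.{u}) ∈ A ↔ (x : ZFSet.{u}) ∈ B) : A = B :=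
  ZFSet.ext fun x => ⟨fun hx => (h ⟨x, hA hx⟩).1 hx, fun hx => (h ⟨x, hB hx⟩).2 hx⟩

theorem IsIdealSet.idealSet_toIdeal {J : ZFSet.{u}} (h : IsIdealSet R J) (hJ : J ⊆ R.carrier) :
    idealSet R h.toIdeal = J :=
  ext_of_subset_carrier (idealSet_subset _) hJ fun _ => coe_mem_idealSet

theorem isIdealSet_idealSet (I : Ideal R.carrier) : IsIdealSet R (idealSet R I) := by
  refine ⟨coe_mem_idealSet.2 I.zero_mem, fun x hx y hy z hz h => ?_, fun r hr x hx z hz h => ?_⟩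
  · lift x to R.carrier using idealSet_subset I hx
    lift y to R.carrier using idealSet_subset I hy
    lift z to R.carrier using hz
    obtain rfl := mem_addGraph.1 h
    exact coe_mem_idealSet.2 (I.add_mem (coe_mem_idealSet.1 hx) (coe_mem_idealSet.1 hy))
  · lift x to R.carrier using idealSet_subset I hx
    lift r to R.carrier using hr
    lift z to R.carrier using hz
    obtain rfl := mem_mulGraph.1 h
    exact coe_mem_idealSet.2 (I.mul_mem_left r (coe_mem_idealSet.1 hx))

variable (R) in
/-- A first-order description of the prime ideals of `R`. -/
abbrev IsPrimeSet (P : ZFSet.{u}) : Prop :=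
  IsIdealSet R P ∧ ((1 : R.carrier) : ZFSet.{u}) ∉ P ∧
    ∀ x ∈ R.carrier, ∀ y ∈ R.carrier, ∀ z ∈ P,
      ZFSet.pair (ZFSet.pair x y) z ∈ R.mulGraph → x ∈ P ∨ y ∈ P

theorem isPrimeIdeal_iff {P : ZFSet.{u}} : IsPrimeIdeal R P ↔ P ⊆ R.carrier ∧ IsPrimeSet R P := by
  constructor
  · rintro ⟨I, hI, rfl⟩
    refine ⟨idealSet_subset I, isIdealSet_idealSet I, fun h => ?_, fun x hx y hy z hz h => ?_⟩
    · exact hI.ne_top ((Ideal.eq_top_iff_one I).2 (coe_mem_idealSet.1 h))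
    · lift z to R.carrier using idealSet_subset I hz
      lift x to R.carrier using hx
      lift y to R.carrier using hy
      obtain rfl := mem_mulGraph.1 h
      exact (hI.mem_or_mem (coe_mem_idealSet.1 hz)).imp coe_mem_idealSet.2 coe_mem_idealSet.2
  · rintro ⟨hP, hI, h1, h⟩
    refine ⟨hI.toIdeal, ⟨fun htop => h1 ?_, fun {x y} hxy => ?_⟩, (hI.idealSet_toIdeal hP).symm⟩
    · exact (Ideal.eq_top_iff_one _).1 htop
    · exact h x x.2 y y.2 _ hxy (mem_mulGraph.2 rfl)

variable [hM : IsTransitiveModel M]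

set_option synthInstance.maxSize 2000 in
/-- A prime ideal `P` of `R` that need not belong to `M`, but contains `B ∈ M`, contains a radical
ideal `J ∈ M` with `B ⊆ J`. This is the radical ideal generated by `B`, built in `M` as the least
set of elements ranked by ordinals of `M`. The ranks show that this set, although it is least only
among the sets in `M`, lies in `P`: an element outside `P` of least rank could be removed from
it, since it does not arise from elements of smaller rank. -/
theorem exists_radical_set_mem_model (P : Ideal R.carrier) (hP : P.IsPrime) {B : ZFSet.{u}}
    (hB : B ∈ M) (hBR : B ⊆ R.carrier)
    (hBP : ∀ b : R.carrier, (b : ZFSet.{u}) ∈ B → b ∈ P) :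
    ∃ J ∈ M, J ⊆ R.carrier ∧ IsIdealSet R J ∧
      (∀ x ∈ R.carrier, ∀ z ∈ J, ZFSet.pair (ZFSet.pair x x) z ∈ R.mulGraph → x ∈ J) ∧
      B ⊆ J ∧ ∀ x : R.carrier, (x : ZFSet.{u}) ∈ J → x ∈ P := by
  obtain ⟨D, hD, ⟨d, hd⟩, hdir⟩ := exists_directed_mem_model (M := M)
  have hDR := prod_mem_model hD R.carrier_mem
  have : InM M D := ⟨hD⟩
  have : InM M B := ⟨hB⟩
  have : InM M (D.prod R.carrier) := ⟨hDR⟩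
  -- `pair i x ∈ V` is read as: `x` is obtained from `B` in steps of rank at most `i`.
  let Closed : ZFSet.{u} → Prop := fun V =>
    (∀ i ∈ D, ZFSet.pair i (0 : R.carrier) ∈ V ∧ ∀ b ∈ B, ZFSet.pair i b ∈ V) ∧
    (∀ i ∈ D, ∀ j ∈ D, ∀ k ∈ D, i ∈ k → j ∈ k → ∀ x ∈ R.carrier, ∀ y ∈ R.carrier,
      ZFSet.pair i x ∈ V → ZFSet.pair j y ∈ V → ∀ z ∈ R.carrier,
        ZFSet.pair (ZFSet.pair x y) z ∈ R.addGraph → ZFSet.pair k z ∈ V) ∧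
    (∀ i ∈ D, ∀ k ∈ D, i ∈ k → ∀ r ∈ R.carrier, ∀ x ∈ R.carrier, ZFSet.pair i x ∈ V →
      ∀ z ∈ R.carrier, ZFSet.pair (ZFSet.pair r x) z ∈ R.mulGraph → ZFSet.pair k z ∈ V) ∧
    (∀ i ∈ D, ∀ k ∈ D, i ∈ k → ∀ x ∈ R.carrier, ∀ z ∈ R.carrier, ZFSet.pair i z ∈ V →
      ZFSet.pair (ZFSet.pair x x) z ∈ R.mulGraph → ZFSet.pair k x ∈ V)
  let W := ZFSet.sep (fun p => ∀ V ∈ M, V ⊆ D.prod R.carrier → Closed V → p ∈ V) (D.prod R.carrier)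
  have hWM : W ∈ M := DefFun.mem_of_const inferInstance
  have : InM M W := ⟨hWM⟩
  have hW : ∀ {i x}, ZFSet.pair i x ∈ W ↔ (i ∈ D ∧ x ∈ R.carrier) ∧
      ∀ V ∈ M, V ⊆ D.prod R.carrier → Closed V → ZFSet.pair i x ∈ V := by
    simp [W]
  have hWR : ∀ {i x}, ZFSet.pair i x ∈ W → i ∈ D ∧ x ∈ R.carrier := fun h => (hW.1 h).1
  have hWc : Closed W := by
    refine ⟨fun i hi => ⟨hW.2 ⟨⟨hi, (0 : R.carrier).2⟩, fun V _ _ hV => (hV.1 i hi).1⟩,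
      fun b hb => hW.2 ⟨⟨hi, hBR hb⟩, fun V _ _ hV => (hV.1 i hi).2 b hb⟩⟩, ?_, ?_, ?_⟩
    · exact fun i hi j hj k hk hik hjk x hx y hy hix hjy z hz h => hW.2 ⟨⟨hk, hz⟩,
        fun V hVM hVD hV => hV.2.1 i hi j hj k hk hik hjk x hx y hy ((hW.1 hix).2 V hVM hVD hV)
          ((hW.1 hjy).2 V hVM hVD hV) z hz h⟩
    · exact fun i hi k hk hik r hr x hx hix z hz h => hW.2 ⟨⟨hk, hz⟩,
        fun V hVM hVD hV => hV.2.2.1 i hi k hk hik r hr x hx ((hW.1 hix).2 V hVM hVD hV) z hz h⟩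
    · exact fun i hi k hk hik x hx z hz hiz h => hW.2 ⟨⟨hk, hx⟩,
        fun V hVM hVD hV => hV.2.2.2 i hi k hk hik x hx z hz ((hW.1 hiz).2 V hVM hVD hV) h⟩
  have hWP : ∀ i, ∀ x : R.carrier, ZFSet.pair i x ∈ W → x ∈ P := by
    intro i
    induction i using ZFSet.inductionOn with
    | h i ih =>
    intro x hix
    by_contra hxP
    have : InM M i := ⟨mem_model hD (hWR hix).1⟩
    -- Since all elements of rank below `i` lie in `P`, the pair of `i` and `x` can be removed.
    have hrem : ∀ {k z}, ZFSet.pair k z ∈ ZFSet.sep (fun p => ¬ p = ZFSet.pair i x) W ↔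
        ZFSet.pair k z ∈ W ∧ ¬ (k = i ∧ z = x) := by
      intro k z
      rw [ZFSet.mem_sep, ZFSet.pair_inj]
    have hmem := (hW.1 hix).2 (ZFSet.sep (fun p => ¬ p = ZFSet.pair i x) W)
      (DefFun.mem_of_const inferInstance)
      (fun p hp => ZFSet.sep_subset (ZFSet.sep_subset hp)) ?_
    · exact (hrem.1 hmem).2 ⟨rfl, rfl⟩
    refine ⟨fun j hj => ⟨hrem.2 ⟨(hWc.1 j hj).1, ?_⟩, fun b hb =>
      hrem.2 ⟨(hWc.1 j hj).2 b hb, ?_⟩⟩, ?_, ?_, ?_⟩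
    · rintro ⟨-, h⟩
      exact hxP (Subtype.ext h ▸ P.zero_mem)
    · rintro ⟨-, rfl⟩
      exact hxP (hBP x hb)
    · intro j hj l hl k hk hjk hlk y hy w hw hjy hlw z hz h
      refine hrem.2 ⟨hWc.2.1 j hj l hl k hk hjk hlk y hy w hw (hrem.1 hjy).1 (hrem.1 hlw).1 z hz h,
        ?_⟩
      rintro ⟨rfl, rfl⟩
      lift y to R.carrier using hy
      lift w to R.carrier using hw
      exact hxP (mem_addGraph.1 h ▸
        P.add_mem (ih j hjk y (hrem.1 hjy).1) (ih l hlk w (hrem.1 hlw).1))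
    · intro j hj k hk hjk r hr y hy hjy z hz h
      refine hrem.2 ⟨hWc.2.2.1 j hj k hk hjk r hr y hy (hrem.1 hjy).1 z hz h, ?_⟩
      rintro ⟨rfl, rfl⟩
      lift y to R.carrier using hy
      lift r to R.carrier using hr
      exact hxP (mem_mulGraph.1 h ▸ P.mul_mem_left r (ih j hjk y (hrem.1 hjy).1))
    · intro j hj k hk hjk y hy z hz hjz h
      refine hrem.2 ⟨hWc.2.2.2 j hj k hk hjk y hy z hz (hrem.1 hjz).1 h, ?_⟩
      rintro ⟨rfl, rfl⟩
      lift z to R.carrier using hz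
      have := ih j hjk z (hrem.1 hjz).1
      rw [← mem_mulGraph.1 h] at this
      exact hxP ((hP.mem_or_mem this).elim id id)
  let J := ZFSet.sep (fun x => ∃ i ∈ D, ZFSet.pair i x ∈ W) R.carrier
  have hJ : ∀ {x}, x ∈ J ↔ x ∈ R.carrier ∧ ∃ i ∈ D, ZFSet.pair i x ∈ W := ZFSet.mem_sep
  refine ⟨J, DefFun.mem_of_const inferInstance, ZFSet.sep_subset, ⟨?_, ?_, ?_⟩, ?_, ?_, ?_⟩
  · exact hJ.2 ⟨(0 : R.carrier).2, d, hd, (hWc.1 d hd).1⟩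
  · intro x hx y hy z hz h
    obtain ⟨hx, i, hi, hix⟩ := hJ.1 hx
    obtain ⟨hy, j, hj, hjy⟩ := hJ.1 hy
    obtain ⟨k, hk, hik, hjk⟩ := hdir i hi j hj
    exact hJ.2 ⟨hz, k, hk, hWc.2.1 i hi j hj k hk hik hjk x hx y hy hix hjy z hz h⟩
  · intro r hr x hx z hz h
    obtain ⟨hx, i, hi, hix⟩ := hJ.1 hx
    obtain ⟨k, hk, hik, -⟩ := hdir i hi i hi
    exact hJ.2 ⟨hz, k, hk, hWc.2.2.1 i hi k hk hik r hr x hx hix z hz h⟩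
  · intro x hx z hz h
    obtain ⟨hz, i, hi, hiz⟩ := hJ.1 hz
    obtain ⟨k, hk, hik, -⟩ := hdir i hi i hi
    exact hJ.2 ⟨hx, k, hk, hWc.2.2.2 i hi k hk hik x hx z hz hiz h⟩
  · exact fun b hb => hJ.2 ⟨hBR hb, d, hd, (hWc.1 d hd).2 b hb⟩
  · intro x hx
    obtain ⟨-, i, -, hi⟩ := hJ.1 hx
    exact hWP i x hi

set_option synthInstance.maxSize 2000 in
/-- A radical ideal in `M` without the element `a` extends to a prime ideal in `M` without `a`: a
maximal radical ideal `K` without `a` is prime, because the colon ideals `(K : x)` are radical. -/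
theorem exists_prime_set_mem_model {J : ZFSet.{u}} (hJM : J ∈ M) (hJR : J ⊆ R.carrier)
    (hJ : IsIdealSet R J)
    (hrad : ∀ x ∈ R.carrier, ∀ z ∈ J, ZFSet.pair (ZFSet.pair x x) z ∈ R.mulGraph → x ∈ J)
    {a : R.carrier} (ha : (a : ZFSet.{u}) ∉ J) :
    ∃ Q ∈ M, IsPrimeIdeal R Q ∧ J ⊆ Q ∧ (a : ZFSet.{u}) ∉ Q := by
  have : InM M J := ⟨hJM⟩
  let X := ZFSet.sep (fun K => IsIdealSet R K ∧
    (∀ x ∈ R.carrier, ∀ z ∈ K, ZFSet.pair (ZFSet.pair x x) z ∈ R.mulGraph → x ∈ K) ∧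
    J ⊆ K ∧ (a : ZFSet.{u}) ∉ K) (powersetIn M R.carrier)
  have hXM : X ∈ M := DefFun.mem_of_const inferInstance
  have hX : ∀ {K}, K ∈ X ↔ K ∈ powersetIn M R.carrier ∧ IsIdealSet R K ∧
    (∀ x ∈ R.carrier, ∀ z ∈ K, ZFSet.pair (ZFSet.pair x x) z ∈ R.mulGraph → x ∈ K) ∧
    J ⊆ K ∧ (a : ZFSet.{u}) ∉ K := ZFSet.mem_sep
  obtain ⟨K, hK, hmax⟩ := exists_maximal_mem_model hXM
    ⟨J, hX.2 ⟨mem_powersetIn.2 ⟨hJR, hJM⟩, hJ, hrad, fun _ h => h, ha⟩⟩ (by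
      rintro 𝒞 h𝒞 hsub ⟨c₀, -, hc₀⟩ hch
      have hsub : ∀ c ∈ 𝒞, _ := fun c hc => hX.1 (hsub hc)
      refine hX.2 ⟨mem_powersetIn.2 ⟨fun x hx => ?_, sUnion_mem_model h𝒞⟩, ⟨?_, ?_, ?_⟩, ?_, ?_, ?_⟩
      · obtain ⟨c, hc, hx⟩ := ZFSet.mem_sUnion.1 hx
        exact (mem_powersetIn.1 (hsub c hc).1).1 hx
      · exact ZFSet.mem_sUnion_of_mem (hsub c₀ hc₀).2.1.1 hc₀
      · intro x hx y hy z hz h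
        obtain ⟨c, hc, hx⟩ := ZFSet.mem_sUnion.1 hx
        obtain ⟨e, he, hy⟩ := ZFSet.mem_sUnion.1 hy
        obtain hce | hec := hch c hc e he
        · exact ZFSet.mem_sUnion_of_mem ((hsub e he).2.1.2.1 x (hce hx) y hy z hz h) he
        · exact ZFSet.mem_sUnion_of_mem ((hsub c hc).2.1.2.1 x hx y (hec hy) z hz h) hc
      · intro r hr x hx z hz h
        obtain ⟨c, hc, hx⟩ := ZFSet.mem_sUnion.1 hx
        exact ZFSet.mem_sUnion_of_mem ((hsub c hc).2.1.2.2 r hr x hx z hz h) hc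
      · intro x hx z hz h
        obtain ⟨c, hc, hz⟩ := ZFSet.mem_sUnion.1 hz
        exact ZFSet.mem_sUnion_of_mem ((hsub c hc).2.2.1 x hx z hz h) hc
      · exact fun x hx => ZFSet.mem_sUnion_of_mem ((hsub c₀ hc₀).2.2.2.1 hx) hc₀
      · intro h
        obtain ⟨c, hc, hac⟩ := ZFSet.mem_sUnion.1 h
        exact (hsub c hc).2.2.2.2 hac)
  obtain ⟨hKp, hKI, hKrad, hJK, haK⟩ := hX.1 hK
  obtain ⟨hKR, hKM⟩ := mem_powersetIn.1 hKp
  have : InM M K := ⟨hKM⟩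
  let I : Ideal R.carrier := hKI.toIdeal
  have hI : ∀ {x : R.carrier}, (x : ZFSet.{u}) ∈ K ↔ x ∈ I := Iff.rfl
  have hIrad : ∀ x, x * x ∈ I → x ∈ I := fun x hx => hKrad x x.2 _ hx (mem_mulGraph.2 rfl)
  have hcolon : ∀ x y, x * a ∉ I → x * y ∈ I → y ∈ I := by
    intro x y hxa hxy
    -- The colon ideal `(K : x)` is an ideal of the same kind, so it equals `K` by maximality.
    let N := ZFSet.sep (fun z => ∃ w ∈ K, ZFSet.pair (ZFSet.pair x z) w ∈ R.mulGraph) R.carrier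
    have hNM : N ∈ M := DefFun.mem_of_const inferInstance
    have hNR : N ⊆ R.carrier := ZFSet.sep_subset
    have hN : ∀ {z : R.carrier}, (z : ZFSet.{u}) ∈ N ↔ x * z ∈ I := by
      intro z
      simp only [N, ZFSet.mem_sep]
      constructor
      · rintro ⟨-, w, hw, h⟩
        lift w to R.carrier using hKR hw
        exact mem_mulGraph.1 h ▸ hw
      · exact fun h => ⟨z.2, _, h, mem_mulGraph.2 rfl⟩
    have hKN : K ⊆ N := by
      intro z hz
      lift z to R.carrier using hKR hz
      exact hN.2 (I.mul_mem_left x hz)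
    rw [← hI, ← hmax N (hX.2 ⟨mem_powersetIn.2 ⟨hNR, hNM⟩, ⟨hKN hKI.1, ?_, ?_⟩, ?_,
      fun z hz => hKN (hJK hz), fun h => hxa (hN.1 h)⟩) hKN]
    · exact hN.2 hxy
    · intro z hz w hw v hv h
      lift z to R.carrier using hNR hz
      lift w to R.carrier using hNR hw
      lift v to R.carrier using hv
      rw [hN] at *
      rw [← mem_addGraph.1 h, mul_add]
      exact I.add_mem hz hw
    · intro z hz w hw v hv h
      lift z to R.carrier using hz
      lift w to R.carrier using hNR hw
      lift v to R.carrier using hv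
      rw [hN] at *
      rw [← mem_mulGraph.1 h, mul_left_comm]
      exact I.mul_mem_left z hw
    · intro z hz w hw h
      lift z to R.carrier using hz
      lift w to R.carrier using hNR hw
      rw [hN] at *
      refine hIrad _ ?_
      rw [← mem_mulGraph.1 h] at hw
      rw [show x * z * (x * z) = x * (x * (z * z)) by ring]
      exact I.mul_mem_left x hw
  have hprime : I.IsPrime := by
    refine ⟨fun h => haK (h ▸ Submodule.mem_top : a ∈ I), fun {x y} hxy => ?_⟩
    by_contra! h
    -- `(K : x)` contains `y ∉ K`, so it contains `a`; hence `(K : a)` contains `x ∉ K`, so it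
    -- contains `a` as well, and `a * a ∈ K`.
    have hxa : x * a ∈ I := by
      by_contra hxa
      exact h.2 (hcolon x y hxa hxy)
    exact h.1 (hcolon a x (fun haa => haK (hIrad a haa)) (mul_comm x a ▸ hxa))
  exact ⟨K, hKM, ⟨I, hprime, (hKI.idealSet_toIdeal hKR).symm⟩, hJK, haK⟩

/-- Prime ideals in `M` suffice to separate a set `B ∈ M` from an element `a`: if some prime ideal
of `R` contains `B` but not `a`, then so does one that belongs to `M`. -/
theorem exists_mem_specIn_of_isPrime (P : Ideal R.carrier) (hP : P.IsPrime) {B : ZFSet.{u}}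
    (hB : B ∈ M) (hBR : B ⊆ R.carrier) (hBP : ∀ b : R.carrier, (b : ZFSet.{u}) ∈ B → b ∈ P)
    {a : R.carrier} (ha : a ∉ P) : ∃ Q ∈ specIn R, B ⊆ Q ∧ (a : ZFSet.{u}) ∉ Q := by
  obtain ⟨J, hJM, hJR, hJ, hrad, hBJ, hJP⟩ := exists_radical_set_mem_model P hP hB hBR hBP
  obtain ⟨Q, hQM, hQ, hJQ, haQ⟩ := exists_prime_set_mem_model hJM hJR hJ hrad
    (fun h => ha (hJP a h))
  exact ⟨Q, ZFSet.mem_sep.2 ⟨ZFSet.mem_powerset.2 (isPrimeIdeal_iff.1 hQ).1, hQM, hQ⟩,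
    fun x hx => hJQ (hBJ hx), haQ⟩

end Ring

end LocaleInterpretation

namespace LocaleInterpretation

/-! ### The Zariski topology of a model -/

section Zariski

variable {M : Set ZFSet.{u}} [hM : IsTransitiveModel M] {R : RingIn M}

omit hM in
theorem exists_ideal_of_mem_specIn {Q : ZFSet.{u}} (hQ : Q ∈ specIn R) :
    ∃ I : Ideal R.carrier, I.IsPrime ∧ ∀ x : R.carrier, (x : ZFSet.{u}) ∈ Q ↔ x ∈ I := by
  obtain ⟨-, -, I, hI, rfl⟩ := ZFSet.mem_sep.1 hQ
  exact ⟨I, hI, fun x => coe_mem_idealSet⟩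

omit hM in
theorem mem_specIn {Q : ZFSet.{u}} : Q ∈ specIn R ↔ Q ∈ M ∧ IsPrimeIdeal R Q := by
  rw [specIn, ZFSet.mem_sep, ZFSet.mem_powerset]
  exact ⟨fun h => h.2, fun h => ⟨(isPrimeIdeal_iff.1 h.2).1, h⟩⟩

set_option synthInstance.maxSize 2000 in
instance : InM M (specIn R) := by
  refine ⟨?_⟩
  convert DefFun.mem_of_const (M := M)
    (c := ZFSet.sep (fun P => IsPrimeSet R P) (powersetIn M R.carrier)) inferInstance using 1
  ext P
  rw [mem_specIn, isPrimeIdeal_iff, ZFSet.mem_sep, mem_powersetIn]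
  tauto

omit hM in
@[simp]
theorem mem_basicOpenIn {a : R.carrier} {Q : ZFSet.{u}} :
    Q ∈ basicOpenIn R a ↔ Q ∈ specIn R ∧ (a : ZFSet.{u}) ∉ Q :=
  ZFSet.mem_sep

omit hM in
theorem basicOpenIn_zero : basicOpenIn R 0 = ∅ := by
  refine (ZFSet.eq_empty _).2 fun Q hQ => ?_
  obtain ⟨hQ, h0⟩ := mem_basicOpenIn.1 hQ
  obtain ⟨I, -, hI⟩ := exists_ideal_of_mem_specIn hQ
  exact h0 ((hI 0).2 I.zero_mem)

omit hM in
theorem basicOpenIn_one : basicOpenIn R 1 = specIn R := by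
  ext Q
  rw [mem_basicOpenIn, and_iff_left_iff_imp]
  intro hQ
  obtain ⟨I, hI, hQI⟩ := exists_ideal_of_mem_specIn hQ
  rw [hQI]
  exact fun h => hI.ne_top ((Ideal.eq_top_iff_one I).2 h)

omit hM in
theorem basicOpenIn_mul (a b : R.carrier) :
    basicOpenIn R (a * b) = basicOpenIn R a ∩ basicOpenIn R b := by
  ext Q
  rw [ZFSet.mem_inter, mem_basicOpenIn, mem_basicOpenIn, mem_basicOpenIn, ← and_and_left]
  refine and_congr_right fun hQ => ?_
  obtain ⟨I, hI, hQI⟩ := exists_ideal_of_mem_specIn hQ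
  rw [hQI, hQI, hQI, hI.mul_mem_iff_mem_or_mem, not_or]

omit hM in
theorem basicOpenIn_add_subset (a b : R.carrier) :
    basicOpenIn R (a + b) ⊆ basicOpenIn R a ∪ basicOpenIn R b := by
  intro Q hQ
  obtain ⟨hQ, hab⟩ := mem_basicOpenIn.1 hQ
  obtain ⟨I, hI, hQI⟩ := exists_ideal_of_mem_specIn hQ
  rw [ZFSet.mem_union, mem_basicOpenIn, mem_basicOpenIn, hQI, hQI]
  rw [hQI] at hab
  by_contra! h
  exact hab (I.add_mem (h.1 hQ) (h.2 hQ))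

omit hM in
theorem basicOpenIn_subset_specIn (a : R.carrier) : basicOpenIn R a ⊆ specIn R :=
  ZFSet.sep_subset

theorem basicOpenIn_mem_model (a : R.carrier) : basicOpenIn R a ∈ M :=
  DefFun.mem_of_const (c := ZFSet.sep (fun P => ¬ (a : ZFSet.{u}) ∈ P) (specIn R)) inferInstance

variable (R) in
/-- The basic open sets contained in `U`. -/
noncomputable def basicCover (U : ZFSet.{u}) : ZFSet.{u} :=
  ZFSet.sep (fun V => ∃ x ∈ R.carrier, V = ZFSet.sep (fun Q => ¬ x ∈ Q) (specIn R) ∧ V ⊆ U)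
    (powersetIn M (specIn R))

theorem mem_basicCover {U V : ZFSet.{u}} :
    V ∈ basicCover R U ↔ ∃ a : R.carrier, V = basicOpenIn R a ∧ V ⊆ U := by
  rw [basicCover, ZFSet.mem_sep, mem_powersetIn]
  constructor
  · rintro ⟨-, x, hx, rfl, h⟩
    exact ⟨⟨x, hx⟩, rfl, h⟩
  · rintro ⟨a, rfl, h⟩
    exact ⟨⟨basicOpenIn_subset_specIn a, basicOpenIn_mem_model a⟩, a, a.2, rfl, h⟩

theorem basicCover_mem_model {U : ZFSet.{u}} (hU : U ∈ M) : basicCover R U ∈ M :=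
  have : InM M U := ⟨hU⟩
  DefFun.mem_of_const (by rw [basicCover]; infer_instance)

variable (R) in
/-- The set of unions in `M` of basic open sets. -/
noncomputable def zariskiIn : ZFSet.{u} :=
  ZFSet.sep (fun U => ∀ P ∈ U, ∃ x ∈ R.carrier, ¬ x ∈ P ∧
    ZFSet.sep (fun Q => ¬ x ∈ Q) (specIn R) ⊆ U) (powersetIn M (specIn R))

omit hM in
theorem mem_zariskiIn {U : ZFSet.{u}} : U ∈ zariskiIn R ↔ (U ⊆ specIn R ∧ U ∈ M) ∧
    ∀ P ∈ U, ∃ a : R.carrier, (a : ZFSet.{u}) ∉ P ∧ basicOpenIn R a ⊆ U := by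
  rw [zariskiIn, ZFSet.mem_sep, mem_powersetIn]
  refine and_congr_right fun _ => forall₂_congr fun P _ => ?_
  exact ⟨fun ⟨x, hx, h⟩ => ⟨⟨x, hx⟩, h⟩, fun ⟨a, h⟩ => ⟨a, a.2, h⟩⟩

theorem basicOpenIn_mem_zariskiIn (a : R.carrier) : basicOpenIn R a ∈ zariskiIn R :=
  mem_zariskiIn.2 ⟨⟨basicOpenIn_subset_specIn a, basicOpenIn_mem_model a⟩,
    fun _ hP => ⟨a, (mem_basicOpenIn.1 hP).2, fun _ h => h⟩⟩

theorem sUnion_basicCover {U : ZFSet.{u}} (hU : U ∈ zariskiIn R) :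
    (ZFSet.sUnion (basicCover R U) : ZFSet.{u}) = U := by
  ext Q
  rw [ZFSet.mem_sUnion]
  constructor
  · rintro ⟨V, hV, hQ⟩
    obtain ⟨a, -, hVU⟩ := mem_basicCover.1 hV
    exact hVU hQ
  · intro hQ
    obtain ⟨⟨hUs, -⟩, h⟩ := mem_zariskiIn.1 hU
    obtain ⟨a, haQ, ha⟩ := h Q hQ
    exact ⟨_, mem_basicCover.2 ⟨a, rfl, ha⟩, mem_basicOpenIn.2 ⟨hUs hQ, haQ⟩⟩

theorem isTopologyIn_zariskiIn : IsTopologyIn M (specIn R) (zariskiIn R) where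
  mem := DefFun.mem_of_const (by rw [zariskiIn]; infer_instance)
  subset U hU := (mem_zariskiIn.1 hU).1.1
  univ_mem := basicOpenIn_one (R := R) ▸ basicOpenIn_mem_zariskiIn 1
  inter_mem U hU V hV := by
    obtain ⟨⟨hUs, hUM⟩, hU⟩ := mem_zariskiIn.1 hU
    obtain ⟨⟨-, hVM⟩, hV⟩ := mem_zariskiIn.1 hV
    have : InM M U := ⟨hUM⟩
    have : InM M V := ⟨hVM⟩
    refine mem_zariskiIn.2 ⟨⟨fun P hP => hUs (ZFSet.mem_inter.1 hP).1, ?_⟩, fun P hP => ?_⟩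
    · exact DefFun.mem_of_const (c := ZFSet.sep (fun P => P ∈ V) U) inferInstance
    · obtain ⟨hPU, hPV⟩ := ZFSet.mem_inter.1 hP
      obtain ⟨a, haP, haU⟩ := hU P hPU
      obtain ⟨b, hbP, hbV⟩ := hV P hPV
      have hPs := hUs hPU
      have hmem : P ∈ basicOpenIn R (a * b) := by
        rw [basicOpenIn_mul, ZFSet.mem_inter]
        exact ⟨mem_basicOpenIn.2 ⟨hPs, haP⟩, mem_basicOpenIn.2 ⟨hPs, hbP⟩⟩
      refine ⟨a * b, (mem_basicOpenIn.1 hmem).2, fun Q hQ => ?_⟩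
      rw [basicOpenIn_mul, ZFSet.mem_inter] at hQ
      exact ZFSet.mem_inter.2 ⟨haU hQ.1, hbV hQ.2⟩
  sUnion_mem 𝒰 h𝒰 hsub := by
    refine mem_zariskiIn.2 ⟨⟨fun P hP => ?_, sUnion_mem_model h𝒰⟩, fun P hP => ?_⟩
    · obtain ⟨U, hU, hP⟩ := ZFSet.mem_sUnion.1 hP
      exact (mem_zariskiIn.1 (hsub hU)).1.1 hP
    · obtain ⟨U, hU, hP⟩ := ZFSet.mem_sUnion.1 hP
      obtain ⟨a, haP, ha⟩ := (mem_zariskiIn.1 (hsub hU)).2 P hP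
      exact ⟨a, haP, fun Q hQ => ZFSet.mem_sUnion_of_mem (ha hQ) hU⟩

theorem opensIn_eq_zariskiIn : opensIn R = zariskiIn R := by
  ext U
  rw [opensIn, ZFSet.mem_sep, ZFSet.mem_powerset]
  constructor
  · exact fun h => h.2.2 _ isTopologyIn_zariskiIn basicOpenIn_mem_zariskiIn
  · intro hU
    obtain ⟨⟨hUs, hUM⟩, -⟩ := mem_zariskiIn.1 hU
    refine ⟨hUs, hUM, fun T hT ha => ?_⟩
    rw [← sUnion_basicCover hU]
    refine hT.sUnion_mem _ (basicCover_mem_model hUM) fun V hV => ?_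
    obtain ⟨a, rfl, -⟩ := mem_basicCover.1 hV
    exact ha a

theorem mem_opensIn {U : ZFSet.{u}} : U ∈ opensIn R ↔ (U ⊆ specIn R ∧ U ∈ M) ∧
    ∀ P ∈ U, ∃ a : R.carrier, (a : ZFSet.{u}) ∉ P ∧ basicOpenIn R a ⊆ U := by
  rw [opensIn_eq_zariskiIn, mem_zariskiIn]

theorem basicOpenIn_mem_opensIn (a : R.carrier) : basicOpenIn R a ∈ opensIn R :=
  opensIn_eq_zariskiIn (R := R) ▸ basicOpenIn_mem_zariskiIn a

variable (R) in
/-- `O_a` as an element of the frame of open sets. -/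
def basicOpen (a : R.carrier) : opensIn R :=
  ⟨basicOpenIn R a, basicOpenIn_mem_opensIn a⟩

theorem isLUB_opensIn_iff {𝒰 : ZFSet.{u}} (h𝒰 : 𝒰 ∈ M) (hsub : 𝒰 ⊆ opensIn R) {U : opensIn R} :
    IsLUB {l : opensIn R | (l : ZFSet.{u}) ∈ 𝒰} U ↔ (U : ZFSet.{u}) = ZFSet.sUnion 𝒰 := by
  have hmem : (ZFSet.sUnion 𝒰 : ZFSet.{u}) ∈ opensIn R := by
    rw [opensIn_eq_zariskiIn] at hsub ⊢
    exact isTopologyIn_zariskiIn.sUnion_mem 𝒰 h𝒰 hsub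
  have hlub : IsLUB {l : opensIn R | (l : ZFSet.{u}) ∈ 𝒰} ⟨ZFSet.sUnion 𝒰, hmem⟩ := by
    refine ⟨fun l hl P hP => ZFSet.mem_sUnion_of_mem hP hl, fun V hV P hP => ?_⟩
    obtain ⟨l, hl, hP⟩ := ZFSet.mem_sUnion.1 hP
    exact hV (show (⟨l, hsub hl⟩ : opensIn R) ∈ {l : opensIn R | (l : ZFSet.{u}) ∈ 𝒰} from hl) hP
  constructor
  · exact fun h => congrArg Subtype.val (h.unique hlub)
  · intro h
    obtain rfl : U = ⟨ZFSet.sUnion 𝒰, hmem⟩ := Subtype.ext h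
    exact hlub

end Zariski

/-! ### Completely prime filters and prime ideals -/

section Points

variable {M : Set ZFSet.{u}} [hM : IsTransitiveModel M] {R : RingIn M}

theorem Hat.exists_mem_of_eq_sUnion (F : Hat M (opensIn R)) {𝒰 : ZFSet.{u}} (h𝒰 : 𝒰 ∈ M)
    (hsub : 𝒰 ⊆ opensIn R) {U : opensIn R} (hU : U ∈ F.1)
    (h : (U : ZFSet.{u}) = ZFSet.sUnion 𝒰) : ∃ l ∈ F.1, (l : ZFSet.{u}) ∈ 𝒰 :=
  F.2 𝒰 h𝒰 hsub U hU ((isLUB_opensIn_iff h𝒰 hsub).2 h)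

/-- A completely prime filter is determined by the basic open sets in it. -/
theorem Hat.mem_iff (F : Hat M (opensIn R)) {U : opensIn R} :
    U ∈ F.1 ↔ ∃ a : R.carrier, basicOpen R a ∈ F.1 ∧ basicOpenIn R a ⊆ U := by
  constructor
  · intro hU
    have hUz : (U : ZFSet.{u}) ∈ zariskiIn R := opensIn_eq_zariskiIn (R := R) ▸ U.2
    obtain ⟨l, hlF, hl⟩ := F.exists_mem_of_eq_sUnion
      (basicCover_mem_model (R := R) (mem_zariskiIn.1 hUz).1.2) (fun V hV => by
        obtain ⟨a, rfl, -⟩ := mem_basicCover.1 hV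
        exact basicOpenIn_mem_opensIn a) hU (sUnion_basicCover hUz).symm
    obtain ⟨a, hla, hlU⟩ := mem_basicCover.1 hl
    obtain rfl : l = basicOpen R a := Subtype.ext hla
    exact ⟨a, hlF, hlU⟩
  · rintro ⟨a, ha, haU⟩
    exact Order.PFilter.mem_of_le (show basicOpen R a ≤ U from haU) ha

theorem Hat.basicOpen_mul_mem (F : Hat M (opensIn R)) {a b : R.carrier} :
    basicOpen R (a * b) ∈ F.1 ↔ basicOpen R a ∈ F.1 ∧ basicOpen R b ∈ F.1 := by
  have hab : ∀ Q, Q ∈ basicOpenIn R (a * b) ↔ Q ∈ basicOpenIn R a ∧ Q ∈ basicOpenIn R b := by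
    simp [basicOpenIn_mul]
  constructor
  · exact fun h =>
      ⟨Order.PFilter.mem_of_le (show basicOpen R (a * b) ≤ _ from fun Q hQ => ((hab Q).1 hQ).1) h,
        Order.PFilter.mem_of_le (show basicOpen R (a * b) ≤ _ from fun Q hQ => ((hab Q).1 hQ).2) h⟩
  · rintro ⟨ha, hb⟩
    obtain ⟨c, hc, hca, hcb⟩ := F.1.directed _ ha _ hb
    exact Order.PFilter.mem_of_le
      (show c ≤ basicOpen R (a * b) from fun Q hQ => (hab Q).2 ⟨hca hQ, hcb hQ⟩) hc

theorem Hat.basicOpen_zero_notMem (F : Hat M (opensIn R)) : basicOpen R 0 ∉ F.1 := by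
  intro h
  have hempty : (∅ : ZFSet.{u}) ∈ M := basicOpenIn_zero (R := R) ▸ basicOpenIn_mem_model 0
  obtain ⟨l, -, hl⟩ := F.exists_mem_of_eq_sUnion hempty (ZFSet.empty_subset _) h
    (by rw [ZFSet.sUnion_empty]; exact basicOpenIn_zero)
  exact ZFSet.notMem_empty _ hl

theorem Hat.basicOpen_one_mem (F : Hat M (opensIn R)) : basicOpen R 1 ∈ F.1 := by
  obtain ⟨U, hU⟩ := F.1.nonempty
  refine Order.PFilter.mem_of_le (show U ≤ basicOpen R 1 from fun Q hQ => ?_) hU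
  have hQs := (mem_opensIn.1 U.2).1.1 hQ
  rwa [← basicOpenIn_one] at hQs

theorem Hat.basicOpen_mem_of_add_mem (F : Hat M (opensIn R)) {a b : R.carrier}
    (h : basicOpen R (a + b) ∈ F.1) : basicOpen R a ∈ F.1 ∨ basicOpen R b ∈ F.1 := by
  have hpM : ({basicOpenIn R a, basicOpenIn R b} : ZFSet.{u}) ∈ M :=
    pair_set_mem_model (basicOpenIn_mem_model a) (basicOpenIn_mem_model b)
  have hsub : ({basicOpenIn R a, basicOpenIn R b} : ZFSet.{u}) ⊆ opensIn R := by
    intro V hV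
    obtain rfl | rfl := ZFSet.mem_pair.1 hV <;> exact basicOpenIn_mem_opensIn _
  have hunion : basicOpenIn R a ∪ basicOpenIn R b ∈ opensIn R := by
    rw [opensIn_eq_zariskiIn] at hsub ⊢
    exact isTopologyIn_zariskiIn.sUnion_mem _ hpM hsub
  obtain ⟨l, hlF, hl⟩ := F.exists_mem_of_eq_sUnion hpM hsub (U := ⟨_, hunion⟩)
    (Order.PFilter.mem_of_le (show basicOpen R (a + b) ≤ _ from basicOpenIn_add_subset a b) h) rfl
  obtain h | h := ZFSet.mem_pair.1 hl
  · obtain rfl : l = basicOpen R a := Subtype.ext h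
    exact Or.inl hlF
  · obtain rfl : l = basicOpen R b := Subtype.ext h
    exact Or.inr hlF

/-- The prime ideal `{a | O_a ∉ F}`. -/
def Hat.toPrimeSpectrum (F : Hat M (opensIn R)) : PrimeSpectrum R.carrier where
  asIdeal :=
    { carrier := {a | basicOpen R a ∉ F.1}
      zero_mem' := F.basicOpen_zero_notMem
      add_mem' := fun ha hb h => (F.basicOpen_mem_of_add_mem h).elim ha hb
      smul_mem' := fun _ _ ha h => ha (F.basicOpen_mul_mem.1 h).2 }
  isPrime := by
    refine ⟨fun h => ?_, fun {a b} hab => ?_⟩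
    · exact (Ideal.eq_top_iff_one _).1 h F.basicOpen_one_mem
    · by_contra h
      rw [not_or] at h
      exact hab (F.basicOpen_mul_mem.2 ⟨not_not.1 h.1, not_not.1 h.2⟩)

theorem Hat.mem_toPrimeSpectrum (F : Hat M (opensIn R)) {a : R.carrier} :
    a ∈ F.toPrimeSpectrum.asIdeal ↔ basicOpen R a ∉ F.1 :=
  Iff.rfl

/-- The filter `{U | O_a ⊆ U for some a ∉ P}`. -/
def primeFilter (P : PrimeSpectrum R.carrier) : Order.PFilter (opensIn R) :=
  Order.IsPFilter.toPFilter
    (F := {U : opensIn R | ∃ a : R.carrier, a ∉ P.asIdeal ∧ basicOpenIn R a ⊆ U})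
    (Order.IsPFilter.of_def
      ⟨basicOpen R 1, 1, fun h => P.isPrime.ne_top ((Ideal.eq_top_iff_one _).2 h), fun _ h => h⟩
      (by
        rintro U ⟨a, ha, haU⟩ V ⟨b, hb, hbV⟩
        have hab : ∀ Q ∈ basicOpenIn R (a * b), Q ∈ basicOpenIn R a ∧ Q ∈ basicOpenIn R b := by
          simp [basicOpenIn_mul]
        exact ⟨basicOpen R (a * b),
          ⟨a * b, fun h => (P.isPrime.mem_or_mem h).elim ha hb, fun _ h => h⟩,
          fun Q hQ => haU (hab Q hQ).1, fun Q hQ => hbV (hab Q hQ).2⟩)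
      (by
        rintro U V hUV ⟨a, ha, haU⟩
        exact ⟨a, ha, fun Q hQ => hUV (haU hQ)⟩))

theorem mem_primeFilter {P : PrimeSpectrum R.carrier} {U : opensIn R} :
    U ∈ primeFilter P ↔ ∃ a : R.carrier, a ∉ P.asIdeal ∧ basicOpenIn R a ⊆ U :=
  Iff.rfl

/-- This is where prime ideals in `M` are needed: if no member of the cover `𝒰` of `O_a` belonged to
the filter of `P`, then `P` would contain the set `B ∈ M` of all `b` with `O_b ⊆ l` for some
`l ∈ 𝒰`, and a prime ideal in `M` containing `B` but not `a` would be a point of `O_a` that `𝒰` does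
not cover. -/
theorem isCompletelyPrimeOver_primeFilter (P : PrimeSpectrum R.carrier) :
    IsCompletelyPrimeOver M (opensIn R) (primeFilter P) := by
  intro 𝒰 h𝒰 hsub U hU hlub
  obtain ⟨a, haP, haU⟩ := mem_primeFilter.1 hU
  rw [isLUB_opensIn_iff h𝒰 hsub] at hlub
  by_contra! hcon
  have : InM M 𝒰 := ⟨h𝒰⟩
  let B := ZFSet.sep (fun x => ∃ l ∈ 𝒰, ZFSet.sep (fun Q => ¬ x ∈ Q) (specIn R) ⊆ l) R.carrier
  have hB : ∀ {b : R.carrier}, (b : ZFSet.{u}) ∈ B ↔ ∃ l ∈ 𝒰, basicOpenIn R b ⊆ l :=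
    ZFSet.mem_sep.trans (and_iff_right (Subtype.property _))
  obtain ⟨Q, hQ, hBQ, haQ⟩ := exists_mem_specIn_of_isPrime P.asIdeal P.isPrime (B := B)
    (DefFun.mem_of_const inferInstance) ZFSet.sep_subset (fun b hb => by
      obtain ⟨l, hl, hbl⟩ := hB.1 hb
      by_contra hbP
      exact hcon ⟨l, hsub hl⟩ ⟨b, hbP, hbl⟩ hl) haP
  have hQU : Q ∈ (U : ZFSet.{u}) := haU (mem_basicOpenIn.2 ⟨hQ, haQ⟩)
  rw [hlub] at hQU
  obtain ⟨l, hl, hQl⟩ := ZFSet.mem_sUnion.1 hQU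
  obtain ⟨b, hbQ, hbl⟩ := (mem_opensIn.1 (hsub hl)).2 Q hQl
  exact hbQ (hBQ (hB.2 ⟨l, hl, hbl⟩))

/-- Inclusions between the basic open sets of `M` hold for all prime ideals of `R`. -/
theorem notMem_of_basicOpenIn_subset (P : PrimeSpectrum R.carrier) {a b : R.carrier}
    (hab : basicOpenIn R a ⊆ basicOpenIn R b) (ha : a ∉ P.asIdeal) : b ∉ P.asIdeal := by
  intro hb
  have : InM M (b : ZFSet.{u}) := inferInstance
  obtain ⟨Q, hQ, hbQ, haQ⟩ := exists_mem_specIn_of_isPrime P.asIdeal P.isPrime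
    (B := {(b : ZFSet.{u})}) (DefFun.mem_of_const inferInstance)
    (fun x hx => ZFSet.mem_singleton.1 hx ▸ b.2)
    (fun x hx => Subtype.ext (ZFSet.mem_singleton.1 hx) ▸ hb) ha
  exact (mem_basicOpenIn.1 (hab (mem_basicOpenIn.2 ⟨hQ, haQ⟩))).2
    (hbQ (ZFSet.mem_singleton.2 rfl))

/-- The filter `primeFilter P` as a point of the space of completely prime filters. -/
def Hat.ofPrimeSpectrum (P : PrimeSpectrum R.carrier) : Hat M (opensIn R) :=
  ⟨primeFilter P, isCompletelyPrimeOver_primeFilter P⟩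

theorem Hat.mem_ofPrimeSpectrum {P : PrimeSpectrum R.carrier} {U : opensIn R} :
    U ∈ (Hat.ofPrimeSpectrum P).1 ↔ ∃ a : R.carrier, a ∉ P.asIdeal ∧ basicOpenIn R a ⊆ U :=
  Iff.rfl

theorem Hat.ofPrimeSpectrum_toPrimeSpectrum (F : Hat M (opensIn R)) :
    Hat.ofPrimeSpectrum F.toPrimeSpectrum = F := by
  refine Subtype.ext (SetLike.ext fun U => ?_)
  rw [F.mem_iff, Hat.mem_ofPrimeSpectrum]
  exact exists_congr fun a => and_congr_left fun _ => not_not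

theorem Hat.toPrimeSpectrum_ofPrimeSpectrum (P : PrimeSpectrum R.carrier) :
    (Hat.ofPrimeSpectrum P).toPrimeSpectrum = P := by
  refine PrimeSpectrum.ext (SetLike.ext fun a => ?_)
  rw [Hat.mem_toPrimeSpectrum, Hat.mem_ofPrimeSpectrum]
  constructor
  · intro h
    by_contra ha
    exact h ⟨a, ha, fun _ h => h⟩
  · rintro ha ⟨b, hb, hba⟩
    exact notMem_of_basicOpenIn_subset P hba hb ha

theorem Hat.continuous_toPrimeSpectrum :
    Continuous (Hat.toPrimeSpectrum : Hat M (opensIn R) → PrimeSpectrum R.carrier) := by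
  rw [PrimeSpectrum.isTopologicalBasis_basic_opens.continuous_iff]
  rintro _ ⟨a, rfl⟩
  refine TopologicalSpace.isOpen_generateFrom_of_mem ⟨basicOpen R a, ?_⟩
  ext F
  exact not_not

theorem Hat.continuous_ofPrimeSpectrum :
    Continuous (Hat.ofPrimeSpectrum : PrimeSpectrum R.carrier → Hat M (opensIn R)) := by
  refine continuous_generateFrom_iff.2 ?_
  rintro _ ⟨U, rfl⟩
  convert isOpen_iUnion fun a : {a : R.carrier // basicOpenIn R a ⊆ U} =>
    (PrimeSpectrum.basicOpen a.1).2
  ext P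
  rw [Set.mem_iUnion]
  exact ⟨fun ⟨a, h1, h2⟩ => ⟨⟨a, h2⟩, h1⟩, fun ⟨⟨a, h2⟩, h1⟩ => ⟨a, h1, h2⟩⟩

variable (R) in
/-- The homeomorphism `F ↦ {a | O_a ∉ F}`. -/
def hatHomeomorph : Hat M (opensIn R) ≃ₜ PrimeSpectrum R.carrier where
  toFun := Hat.toPrimeSpectrum
  invFun := Hat.ofPrimeSpectrum
  left_inv := Hat.ofPrimeSpectrum_toPrimeSpectrum
  right_inv := Hat.toPrimeSpectrum_ofPrimeSpectrum
  continuous_toFun := Hat.continuous_toPrimeSpectrum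
  continuous_invFun := Hat.continuous_ofPrimeSpectrum

end Points

/-! ### Naturality -/

section Naturality

variable {M : Set ZFSet.{u}} [hM : IsTransitiveModel M] {R S : RingIn M}
  {φ : R.carrier →+* S.carrier}

/-- The contraction `φ⁻¹(Q)` of a set `Q`. -/
noncomputable def contractionIn (φ : R.carrier →+* S.carrier) (Q : ZFSet.{u}) : ZFSet.{u} :=
  ZFSet.sep (fun x => ∃ h : x ∈ R.carrier, (φ ⟨x, h⟩ : ZFSet.{u}) ∈ Q) R.carrier

omit hM in
theorem coe_mem_contractionIn {Q : ZFSet.{u}} {x : R.carrier} :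
    (x : ZFSet.{u}) ∈ contractionIn φ Q ↔ (φ x : ZFSet.{u}) ∈ Q :=
  ZFSet.mem_sep.trans ⟨fun ⟨_, _, h⟩ => h, fun h => ⟨x.2, x.2, h⟩⟩

omit hM in
theorem mem_specPreimageIn {U Q : ZFSet.{u}} :
    Q ∈ specPreimageIn φ U ↔ Q ∈ specIn S ∧ contractionIn φ Q ∈ U :=
  ZFSet.mem_sep

theorem HomIn.defFun_contractionIn (hφ : HomIn φ) {Γ : Type (u + 1)} [Ctx M Γ]
    (f : Γ → ZFSet.{u}) [DefFun M f] : DefFun M (fun γ => contractionIn φ (f γ)) := by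
  let G := ZFSet.range (fun a : R.carrier => ZFSet.pair a (φ a))
  have : InM M G := ⟨hφ⟩
  have hG : ∀ {a : R.carrier} {y}, ZFSet.pair a y ∈ G ↔ y = φ a := by
    intro a y
    simp only [G, ZFSet.mem_range, ZFSet.pair_inj]
    constructor
    · rintro ⟨b, hb, rfl⟩
      rw [Subtype.ext hb]
    · rintro rfl
      exact ⟨a, rfl, rfl⟩
  have hf := ‹DefFun M f›.weaken (fun δ : Γ × M => δ.1)
  have h : DefFun M (fun γ => ZFSet.sep (fun x => ∃ y ∈ f γ, ZFSet.pair x y ∈ G) R.carrier) :=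
    inferInstance
  convert h using 2 with γ
  refine ext_of_subset_carrier ZFSet.sep_subset ZFSet.sep_subset fun x => ?_
  rw [coe_mem_contractionIn, ZFSet.mem_sep, and_iff_right x.2]
  simp only [hG]
  exact ⟨fun h => ⟨_, h, rfl⟩, fun ⟨_, h, h'⟩ => h' ▸ h⟩

theorem HomIn.contractionIn_mem_specIn (hφ : HomIn φ) {Q : ZFSet.{u}} (hQ : Q ∈ specIn S) :
    contractionIn φ Q ∈ specIn R := by
  have hQM := (mem_specIn.1 hQ).1
  have : InM M Q := ⟨hQM⟩
  obtain ⟨I, hI, hQI⟩ := exists_ideal_of_mem_specIn hQ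
  refine mem_specIn.2 ⟨(hφ.defFun_contractionIn (fun _ : PUnit => Q)).mem_of_const,
    I.comap φ, inferInstance, ?_⟩
  refine ext_of_subset_carrier ZFSet.sep_subset (idealSet_subset (I.comap φ)) fun x => ?_
  rw [coe_mem_contractionIn, hQI]
  exact (coe_mem_idealSet (I := I.comap φ)).symm

theorem HomIn.mem_specPreimageIn_basicOpenIn (hφ : HomIn φ) {a : R.carrier} {Q : ZFSet.{u}} :
    Q ∈ specPreimageIn φ (basicOpenIn R a) ↔ Q ∈ basicOpenIn S (φ a) := by
  rw [mem_specPreimageIn, mem_basicOpenIn, mem_basicOpenIn, coe_mem_contractionIn]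
  exact and_congr_right fun hQ => and_iff_right (hφ.contractionIn_mem_specIn hQ)

theorem HomIn.basicOpenIn_subset_specPreimageIn (hφ : HomIn φ) {a : R.carrier} {U : ZFSet.{u}}
    (haU : basicOpenIn R a ⊆ U) : basicOpenIn S (φ a) ⊆ specPreimageIn φ U := by
  intro Q hQ
  obtain ⟨hQS, hQ⟩ := mem_specPreimageIn.1 (hφ.mem_specPreimageIn_basicOpenIn.2 hQ)
  exact mem_specPreimageIn.2 ⟨hQS, haU hQ⟩

theorem HomIn.exists_basicOpenIn_of_mem_specPreimageIn {U Q : ZFSet.{u}} (hU : U ∈ opensIn R)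
    (hQ : Q ∈ specPreimageIn φ U) :
    ∃ a : R.carrier, basicOpenIn R a ⊆ U ∧ Q ∈ basicOpenIn S (φ a) := by
  obtain ⟨hQS, hQU⟩ := mem_specPreimageIn.1 hQ
  obtain ⟨a, ha, haU⟩ := (mem_opensIn.1 hU).2 _ hQU
  exact ⟨a, haU, mem_basicOpenIn.2 ⟨hQS, fun h => ha (coe_mem_contractionIn.2 h)⟩⟩

theorem HomIn.specPreimageIn_mem_opensIn (hφ : HomIn φ) {U : ZFSet.{u}} (hU : U ∈ opensIn R) :
    specPreimageIn φ U ∈ opensIn S := by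
  refine mem_opensIn.2 ⟨⟨ZFSet.sep_subset, ?_⟩, fun Q hQ => ?_⟩
  · have : InM M U := ⟨(mem_opensIn.1 hU).1.2⟩
    have := hφ.defFun_contractionIn (fun δ : PUnit × M => (δ.2 : ZFSet.{u}))
    exact DefFun.mem_of_const (c := ZFSet.sep (fun Q => contractionIn φ Q ∈ U) (specIn S))
      inferInstance
  · obtain ⟨a, haU, hQa⟩ := exists_basicOpenIn_of_mem_specPreimageIn hU hQ
    exact ⟨φ a, (mem_basicOpenIn.1 hQa).2, hφ.basicOpenIn_subset_specPreimageIn haU⟩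

/-- A filter that is completely prime over `M` contains `φ*U` only if it contains some `O_{φ(a)}`
with `O_a ⊆ U`, since these sets cover `φ*U` in `M`. -/
theorem HomIn.specPreimageIn_mem_iff (hφ : HomIn φ) (F : Hat M (opensIn S)) (U : opensIn R) :
    (⟨specPreimageIn φ U, hφ.specPreimageIn_mem_opensIn U.2⟩ : opensIn S) ∈ F.1 ↔
      ∃ a : R.carrier, basicOpen S (φ a) ∈ F.1 ∧ basicOpenIn R a ⊆ U := by
  constructor
  · intro h
    have hUM := (mem_opensIn.1 U.2).1.2
    have : InM M (U : ZFSet.{u}) := ⟨hUM⟩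
    let G := ZFSet.range (fun a : R.carrier => ZFSet.pair a (φ a))
    have : InM M G := ⟨hφ⟩
    let 𝒰 := ZFSet.sep (fun V => ∃ x ∈ R.carrier, ZFSet.sep (fun Q => ¬ x ∈ Q) (specIn R) ⊆ U ∧
      ∃ y ∈ S.carrier, ZFSet.pair x y ∈ G ∧ V = ZFSet.sep (fun Q => ¬ y ∈ Q) (specIn S))
      (powersetIn M (specIn S))
    have h𝒰M : 𝒰 ∈ M := DefFun.mem_of_const inferInstance
    have h𝒰 : ∀ {V}, V ∈ 𝒰 ↔
        ∃ a : R.carrier, basicOpenIn R a ⊆ U ∧ V = basicOpenIn S (φ a) := by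
      intro V
      simp only [𝒰, ZFSet.mem_sep, mem_powersetIn]
      constructor
      · rintro ⟨-, x, hx, hxU, y, -, hxy, rfl⟩
        obtain ⟨a, ha⟩ := ZFSet.mem_range.1 hxy
        obtain ⟨rfl, rfl⟩ := ZFSet.pair_inj.1 ha
        exact ⟨a, hxU, rfl⟩
      · rintro ⟨a, haU, rfl⟩
        exact ⟨⟨basicOpenIn_subset_specIn _, basicOpenIn_mem_model _⟩, a, a.2, haU, φ a, (φ a).2,
          ZFSet.mem_range.2 ⟨a, rfl⟩, rfl⟩
    obtain ⟨l, hlF, hl⟩ := F.exists_mem_of_eq_sUnion h𝒰M (fun V hV => by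
      obtain ⟨a, -, rfl⟩ := h𝒰.1 hV
      exact basicOpenIn_mem_opensIn _) h (by
        ext Q
        rw [ZFSet.mem_sUnion]
        constructor
        · intro hQ
          obtain ⟨a, haU, hQa⟩ := exists_basicOpenIn_of_mem_specPreimageIn U.2 hQ
          exact ⟨_, h𝒰.2 ⟨a, haU, rfl⟩, hQa⟩
        · rintro ⟨V, hV, hQ⟩
          obtain ⟨a, haU, rfl⟩ := h𝒰.1 hV
          exact hφ.basicOpenIn_subset_specPreimageIn haU hQ)
    obtain ⟨a, haU, hla⟩ := h𝒰.1 hl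
    obtain rfl : l = basicOpen S (φ a) := Subtype.ext hla
    exact ⟨a, hlF, haU⟩
  · rintro ⟨a, ha, haU⟩
    exact Order.PFilter.mem_of_le
      (show basicOpen S (φ a) ≤ _ from hφ.basicOpenIn_subset_specPreimageIn haU) ha

end Naturality

end LocaleInterpretation

theorem mainTheorem12 (M : Set ZFSet.{u}) (hM : ∀ x ∈ M, ∀ y ∈ x, y ∈ M) (hZFC : M ⊨ ZFC) :
    ∃ (hO : ∀ (R : RingIn M) (a : R.carrier), basicOpenIn R a ∈ opensIn R)
      (hpre : ∀ (R S : RingIn M) (φ : R.carrier →+* S.carrier), HomIn φ →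
        ∀ U : opensIn R, specPreimageIn φ U ∈ opensIn S)
      (e : ∀ R : RingIn M, Hat M (opensIn R) ≃ₜ PrimeSpectrum R.carrier),
      (∀ (R : RingIn M) (F : Hat M (opensIn R)) (a : R.carrier),
        a ∈ (e R F).asIdeal ↔ (⟨basicOpenIn R a, hO R a⟩ : opensIn R) ∉ F.1) ∧
      (∀ (R : RingIn M) (P : PrimeSpectrum R.carrier) (U : opensIn R),
        U ∈ ((e R).symm P).1 ↔ ∃ a : R.carrier, a ∉ P.asIdeal ∧ basicOpenIn R a ⊆ U) ∧
      (∀ (R S : RingIn M) (φ : R.carrier →+* S.carrier) (hφ : HomIn φ)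
        (F : Hat M (opensIn S)), ∃ F' : Hat M (opensIn R),
          (∀ U : opensIn R,
            U ∈ F'.1 ↔ (⟨specPreimageIn φ U, hpre R S φ hφ U⟩ : opensIn S) ∈ F.1) ∧
          e R F' = PrimeSpectrum.comap φ (e S F)) := by
  have : IsTransitiveModel M := ⟨hM, hZFC⟩
  refine ⟨fun R a => basicOpenIn_mem_opensIn a, fun R S φ hφ U => hφ.specPreimageIn_mem_opensIn U.2,
    fun R => hatHomeomorph R, fun R F a => Iff.rfl, fun R P U => Iff.rfl, fun R S φ hφ F =>
      ⟨(hatHomeomorph R).symm (PrimeSpectrum.comap φ (hatHomeomorph S F)), fun U => ?_,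
        (hatHomeomorph R).apply_symm_apply _⟩⟩
  rw [hφ.specPreimageIn_mem_iff F U]
  exact exists_congr fun a => and_congr_left fun _ => not_not
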